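/- **Setting.** A trial-offer (T-O) market has finitely many user types $i\in\mathcal U$ and a non-empty finite set of items $\mathcal I$; type $i$ has population fraction $w_i>0$ ($\sum_i w_i=1$), visibilities $v_{ij}\ge 0$, qualities $q_{ij}\in[0,1]$ and a feedback exponent $r_i\ge 0$. Every item $j$ satisfies $v_{ij}q_{ij}>0$ for at least one type $i$. For $\phi$ in the simplex $\Delta$ of market shares put $$\tilde y_{ij}(\phi)=\frac{v_{ij}\phi_j^{r_i}}{\sum_{k}v_{ik}\phi_k^{r_i}},\qquad b_{ij}(\phi)=w_iq_{ij}\,\tilde y_{ij}(\phi),\qquad y_j(\phi)=\sum_i b_{ij}(\phi),\qquad p_j(\phi)=\frac{y_j(\phi)}{\sum_k y_k(\phi)}$$ (with $\tilde y_{ij}(\phi)=0$ if its denominator is $0$). A T-O market equilibrium (TOME) is a $\phi\in\Delta$ with $p(\phi)=\phi$; it is interior if $\phi_j>0$ for all $j$. The stochastic dynamic starts with numbers of purchases $d^0_j\in\mathbb N$. At each time $t\ge1$, given the past, a user of type $i$ arrives with probability $w_i$, tries item $j$ with probability $\tilde y_{ij}(\phi^{t-1})$ (tries no item with the remaining probability),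 and then purchases the tried item with probability $q_{ij}$. Here $d^t_j$ is the number of purchases of item $j$ up to time $t$ (initial ones included) and $\phi^t_j=d^t_j/\sum_k d^t_k$. For $r\ge0$, visibilities $v_{ij}$ and qualities $q_j>0$ that do not depend on the type, let $$\Gamma(\mathbf b)=r\sum_j\frac{b_j}{q_j}\log b_j-\sum_i\sum_j\frac{b_{ij}}{q_j}\log\frac{b_{ij}}{q_jv_{ij}},\qquad b_j=\sum_i b_{ij},$$ (with $0\log 0=0\log\frac00=0$ and $x\log\frac x0=+\infty$ for $x>0$, so that $\Gamma$ may be $-\infty$), and let $\Gamma^*$ be the maximum of $\Gamma$ subject to $\sum_j b_{ij}/q_j=w_i$ for all $i$ and $b_{ij}\ge0$. **Theorem.** Take a T-O market as above with a common exponent $r_i=r$ for all $i$, and let $\phi^0_j>0$ for all $j$. Assume that (1) $v_{ij}=v_j$ for all $i,j$, or (2) $q_{ij}=q_j$ for all $i,j$. (a) If $0\le r<1$, the market has exactly one interior TOME $\phi^*$, and $\lim_{t\to\infty}\phi^t=\phi^*$ almost surely. (b) Let $0\le r\le1$ and, for $t\ge1$, $\mathbf b^t=(b_{ij}(\phi^{t-1}))_{i,j}$.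 In case (2), if every type $i$ has $v_{ij}>0$ for some item $j$, then the maximum $\Gamma^*$ exists and is finite, and $\lim_{t\to\infty}\Gamma(\mathbf b^t)=\Gamma^*$ almost surely. In case (1), the same holds for the equivalent market with a single user type (of fraction $1$), visibilities $v_j$ and averaged qualities $\tilde q_j=\sum_i w_iq_{ij}$: for its objective $\Gamma$, its maximum $\Gamma^*$ (over $b_j\ge0$ with $\sum_j b_j/\tilde q_j=1$) and its spendings $b_j^t=\sum_i b_{ij}(\phi^{t-1})$, one has $\lim_{t\to\infty}\Gamma(\mathbf b^t)=\Gamma^*$ almost surely. -/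

import Mathlib

open MeasureTheory Filter Topology

noncomputable section

/-- A trial-offer market with finitely many user types `U` and items `I`. -/
structure TrialOfferMarket (U I : Type*) [Fintype U] where
  /-- the fraction of users of each type -/
  w : U → ℝ
  /-- `v i j` is the visibility of item `j` to type-`i` users -/
  v : U → I → ℝ
  /-- `q i j` is the quality of item `j` for type-`i` users -/
  q : U → I → ℝ
  /-- the feedback exponent of each type -/
  r : U → ℝ
  w_pos : ∀ i, 0 < w i
  w_sum : ∑ i, w i = 1
  v_nonneg : ∀ i j, 0 ≤ v i j
  q_nonneg : ∀ i j, 0 ≤ q i j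
  q_le_one : ∀ i j, q i j ≤ 1
  r_nonneg : ∀ i, 0 ≤ r i

/-- What happens in one round: the type of the arriving user, and then either `none` (no item is
tried) or `some (j, bought)` (item `j` is tried, and purchased exactly if `bought = true`). -/
abbrev TrialOfferOutcome (U I : Type*) := U × Option (I × Bool)

namespace TrialOfferMarket

variable {U I : Type*} [Fintype U] [Fintype I]

/-- The market shares belonging to given numbers of purchases. -/
def share (d : I → ℕ) (j : I) : ℝ := (d j : ℝ) / ∑ k, (d k : ℝ)

/-- The number of purchases of each item up to time `t`, given the initial numbers `d₀` and the
outcomes `X 1, X 2, …` of the rounds (`X 0` is not used). -/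
def purchases {Ω : Type*} (d₀ : I → ℕ) (X : ℕ → Ω → TrialOfferOutcome U I)
    (t : ℕ) (ω : Ω) (j : I) : ℕ :=
  open Classical in
  d₀ j + ((Finset.Icc 1 t).filter fun s => ∃ i, X s ω = (i, some (j, true))).card

variable (M : TrialOfferMarket U I)

/-- The probability that a type-`i` user tries item `j` at market share `φ` (it is `0` if the
denominator vanishes). -/
def tryProb (φ : I → ℝ) (i : U) (j : I) : ℝ :=
  M.v i j * φ j ^ M.r i / ∑ k, M.v i k * φ k ^ M.r i

/-- The probability of each outcome of a round at market share `φ`. -/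
def roundProb (φ : I → ℝ) : TrialOfferOutcome U I → ℝ
  | (i, none) => M.w i * (1 - ∑ j, M.tryProb φ i j)
  | (i, some (j, true)) => M.w i * M.tryProb φ i j * M.q i j
  | (i, some (j, false)) => M.w i * M.tryProb φ i j * (1 - M.q i j)

/-- `X` is the stochastic trial-offer dynamic started from the numbers of purchases `d₀`: the
outcome `X t` of round `t ≥ 1` is known at time `t`, and given the past up to time `t`, the outcome
of round `t + 1` has the law that `roundProb` prescribes at the current market share. -/
structure IsDynamic (d₀ : I → ℕ) {Ω : Type*} [m₀ : MeasurableSpace Ω] (μ : Measure Ω)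
    (ℱ : Filtration ℕ m₀) (X : ℕ → Ω → TrialOfferOutcome U I) : Prop where
  adapted : ∀ t, 1 ≤ t → ∀ e, MeasurableSet[ℱ t] {ω | X t ω = e}
  law : ∀ t e, μ[({ω | X (t + 1) ω = e}.indicator fun _ => (1 : ℝ)) | ℱ t] =ᵐ[μ]
    fun ω => M.roundProb (share (purchases d₀ X t ω)) e

/-- The spendings `b i j = w i * q i j * (v i j φ_j ^ r_i) / ∑ k, v i k φ_k ^ r_i` at market
share `φ`. -/
def spending (φ : I → ℝ) (i : U) (j : I) : ℝ := M.w i * M.q i j * M.tryProb φ i j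

/-- The probability `y j` that item `j` is tried and purchased in a round at market share `φ`. -/
def buyProb (φ : I → ℝ) (j : I) : ℝ := ∑ i, M.spending φ i j

/-- The probability `p j` that the next purchase is for item `j`. -/
def nextProb (φ : I → ℝ) (j : I) : ℝ := M.buyProb φ j / ∑ k, M.buyProb φ k

/-- Trial-offer market equilibrium. -/
def IsTOME (φ : I → ℝ) : Prop := φ ∈ stdSimplex ℝ I ∧ M.nextProb φ = φ

/-- Interior trial-offer market equilibrium. -/
def IsInteriorTOME (φ : I → ℝ) : Prop := M.IsTOME φ ∧ ∀ j, 0 < φ j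

open Classical in
/-- The objective
`Γ(b) = r ∑_j (b_j / q_j) log b_j - ∑_i ∑_j (b_ij / q_j) log (b_ij / (q_j v_ij))`, `b_j = ∑_i b_ij`,
with the usual conventions `0 log 0 = 0 log (0 / 0) = 0` and `x log (x / 0) = ∞` for `x > 0`;
the value is `-∞` as soon as the latter occurs. -/
def Gamma (r : ℝ) (v : U → I → ℝ) (q : I → ℝ) (b : U → I → ℝ) : EReal :=
  if ∃ i j, v i j = 0 ∧ b i j ≠ 0 then ⊥
  else ((r * ∑ j, (∑ i, b i j) / q j * Real.log (∑ i, b i j)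
    - ∑ i, ∑ j, b i j / q j * Real.log (b i j / (q j * v i j)) : ℝ) : EReal)

/-- The feasible set of the maximisation of `Gamma`. -/
def feasible (w : U → ℝ) (q : I → ℝ) : Set (U → I → ℝ) :=
  {b | (∀ i, ∑ j, b i j / q j = w i) ∧ ∀ i j, 0 ≤ b i j}

end TrialOfferMarket

end

/-! Both cases reduce to a market with type-independent positive qualities q_j in which every type
sees an item: in case (1) all types are averaged into one, in case (2) the types that see nothing
are dropped. Either way `buyProb` changes only by a constant factor. Trial probabilities are
homogeneous of degree 0, so shares may be rescaled to x_j = d_j / N with N = ∑ d_j / q_j. Then y =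
`buyProb` maps positive points into the simplex ∑ x_j / q_j = 1, and interior equilibria are, up to
scaling, its positive fixed points.

The potential Φ(x) = ∑ w_i log ∑_k v_ik x_k^r governs the rest. Gibbs' inequality gives Γ(b) ≤ Φ(∑_i
b_i) - const (`gammaVal_le`), and the spendings at x have Γ = Φ(x) - const + r KL(y(x) | x)
(`gammaVal_spending'`). Hence max Γ = max Φ - const, a maximiser of Φ is a fixed point if r > 0, and
Φ(x^t) → max Φ forces Γ(b^t) → Γ*. For 0 < r < 1 a maximiser is interior, because t^r has infinite
slope at 0.

For an interior fixed point z, log m ≤ m - 1 yields ∑ (z_j / q_j)(y_j / x_j) ≥ 1 + Φ(z) - Φ(x) + (1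
- r) KL(z | x) (`drift_of_fixedPoint`). The left side minus 1, divided by N, bounds from below the
expected increment of `logScore`, which is -KL(z | x) up to a constant and terms in 1 / d_j. If z
also maximises Φ, this is a submartingale bounded above: it converges, and (1 - r) KL / N is
summable along the path. Since N grows at most linearly and the harmonic series diverges, KL tends
to 0 when r < 1. Using the drift inequality in both directions gives uniqueness.

For r = 1 the same argument only makes (Φ(z) - Φ(x^t)) / N summable. That Φ(x^t) converges at all
comes from a second submartingale, `potentialScore`, whose drift is nonnegative by Cauchy–Schwarz.
-/

set_option linter.unusedSectionVars false

/-! ### Gibbs' inequality, term by term -/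

/-- A sharpened form of Gibbs' inequality, for one term. -/
theorem sq_sqrt_sub_sqrt_add_sub_le_mul_log_div {a b : ℝ} (ha : 0 ≤ a) (hb : 0 ≤ b)
    (hab : b = 0 → a = 0) : (√a - √b) ^ 2 + (a - b) ≤ a * Real.log (a / b) := by
  have hsa := Real.sq_sqrt ha
  have hsb := Real.sq_sqrt hb
  rcases ha.eq_or_lt with rfl | ha
  · simp [hsb]
  have hb' : 0 < b := hb.lt_of_ne fun h => ha.ne' (hab h.symm)
  -- Bounding log √(a/b) rather than log (a/b) gains the square: 2a(1 - √b/√a) = (√a - √b)² + (a -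
  -- b).
  have h1 := Real.one_sub_inv_le_log_of_pos (div_pos (Real.sqrt_pos.2 ha) (Real.sqrt_pos.2 hb'))
  have h2 : Real.log (a / b) = 2 * Real.log (√a / √b) := by
    rw [← Real.sqrt_div ha.le, Real.log_sqrt (by positivity)]; ring
  have h3 : a * (√a / √b)⁻¹ = √a * √b := by
    have := (Real.sqrt_pos.2 ha).ne'
    rw [inv_div]
    field_simp
    rw [hsa]
  rw [h2]
  nlinarith [mul_le_mul_of_nonneg_left h1 ha.le]

theorem sub_le_mul_log_div {a b : ℝ} (ha : 0 ≤ a) (hb : 0 ≤ b) (hab : b = 0 → a = 0) :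
    a - b ≤ a * Real.log (a / b) := by
  linarith [sq_sqrt_sub_sqrt_add_sub_le_mul_log_div ha hb hab, sq_nonneg (√a - √b)]

/-! ### Homogeneous markets: objective and potential -/

namespace TrialOfferMarket

variable {U I : Type*} [Fintype U] [Fintype I]

/-- All types share the exponent `r` and the positive qualities `q`, every type sees some item and
every item is seen by some type. -/
structure IsHomogeneous (M : TrialOfferMarket U I) (q : I → ℝ) (r : ℝ) : Prop where
  r_eq : ∀ i, M.r i = r
  q_eq : ∀ i j, M.q i j = q j
  q_pos : ∀ j, 0 < q j
  sees : ∀ i, ∃ j, 0 < M.v i j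
  seen : ∀ j, ∃ i, 0 < M.v i j

/-- The denominator of the trial probabilities of type `i`. -/
noncomputable def attraction (M : TrialOfferMarket U I) (r : ℝ) (x : I → ℝ) (i : U) : ℝ :=
  ∑ k, M.v i k * x k ^ r

/-- The average logarithmic attraction. -/
noncomputable def potential (M : TrialOfferMarket U I) (r : ℝ) (x : I → ℝ) : ℝ :=
  ∑ i, M.w i * Real.log (M.attraction r x i)

/-- The probability that item `j` is tried in a round. -/
noncomputable def demand (M : TrialOfferMarket U I) (x : I → ℝ) (j : I) : ℝ :=
  ∑ i, M.w i * M.tryProb x i j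

/-- Nonnegative vectors with `∑ j, x j / q j = 1`. -/
def qualitySimplex (q : I → ℝ) : Set (I → ℝ) := {x | (∀ j, 0 ≤ x j) ∧ ∑ j, x j / q j = 1}

/-- The finite branch of `Gamma`. -/
noncomputable def gammaVal (r : ℝ) (v : U → I → ℝ) (q : I → ℝ) (b : U → I → ℝ) : ℝ :=
  r * ∑ j, (∑ i, b i j) / q j * Real.log (∑ i, b i j)
    - ∑ i, ∑ j, b i j / q j * Real.log (b i j / (q j * v i j))

theorem Gamma_eq_gammaVal {r : ℝ} {v : U → I → ℝ} {q : I → ℝ} {b : U → I → ℝ}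
    (hb : ∀ i j, v i j = 0 → b i j = 0) : Gamma r v q b = (gammaVal r v q b : EReal) := by
  unfold Gamma gammaVal
  rw [if_neg]
  rintro ⟨i, j, h, h'⟩
  exact h' (hb i j h)

theorem Gamma_eq_bot {r : ℝ} {v : U → I → ℝ} {q : I → ℝ} {b : U → I → ℝ}
    (hb : ¬ ∀ i j, v i j = 0 → b i j = 0) : Gamma r v q b = ⊥ := by
  unfold Gamma
  rw [if_pos]
  push Not at hb
  exact hb

theorem attraction_nonneg (M : TrialOfferMarket U I) (r : ℝ) {x : I → ℝ} (hx : ∀ j, 0 ≤ x j)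
    (i : U) : 0 ≤ M.attraction r x i :=
  Finset.sum_nonneg fun k _ => mul_nonneg (M.v_nonneg i k) (Real.rpow_nonneg (hx k) r)

namespace IsHomogeneous

variable {M : TrialOfferMarket U I} {q : I → ℝ} {r : ℝ}

theorem nonempty (h : M.IsHomogeneous q r) : Nonempty I ∧ Nonempty U := by
  have hU : Nonempty U := by
    by_contra hU
    rw [not_nonempty_iff] at hU
    simpa using M.w_sum
  obtain ⟨i⟩ := hU
  obtain ⟨j, -⟩ := h.sees i
  exact ⟨⟨j⟩, ⟨i⟩⟩

theorem r_nonneg (h : M.IsHomogeneous q r) : 0 ≤ r := by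
  obtain ⟨-, ⟨i⟩⟩ := h.nonempty
  exact h.r_eq i ▸ M.r_nonneg i

theorem tryProb_eq (h : M.IsHomogeneous q r) (x : I → ℝ) (i : U) (j : I) :
    M.tryProb x i j = M.v i j * x j ^ r / M.attraction r x i := by
  simp [tryProb, attraction, h.r_eq]

theorem attraction_pos_of (_h : M.IsHomogeneous q r) {x : I → ℝ} (hx : ∀ j, 0 ≤ x j) {i : U}
    {j : I} (hv : 0 < M.v i j) (hj : 0 < x j) : 0 < M.attraction r x i :=
  Finset.sum_pos' (fun k _ => mul_nonneg (M.v_nonneg i k) (Real.rpow_nonneg (hx k) r))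
    ⟨j, Finset.mem_univ j, mul_pos hv (Real.rpow_pos_of_pos hj r)⟩

theorem attraction_pos (h : M.IsHomogeneous q r) {x : I → ℝ} (hx : ∀ j, 0 < x j) (i : U) :
    0 < M.attraction r x i := by
  obtain ⟨j, hj⟩ := h.sees i
  exact h.attraction_pos_of (fun j => (hx j).le) hj (hx j)

theorem tryProb_nonneg (h : M.IsHomogeneous q r) {x : I → ℝ} (hx : ∀ j, 0 ≤ x j) (i : U) (j : I) :
    0 ≤ M.tryProb x i j := by
  rw [h.tryProb_eq]
  exact div_nonneg (mul_nonneg (M.v_nonneg i j) (Real.rpow_nonneg (hx j) r))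
    (M.attraction_nonneg r hx i)

theorem sum_tryProb (h : M.IsHomogeneous q r) {x : I → ℝ} {i : U}
    (hS : 0 < M.attraction r x i) : ∑ j, M.tryProb x i j = 1 := by
  simp_rw [h.tryProb_eq, ← Finset.sum_div]
  exact div_self hS.ne'

theorem tryProb_le_one (h : M.IsHomogeneous q r) {x : I → ℝ} (hx : ∀ j, 0 ≤ x j) {i : U}
    (hS : 0 < M.attraction r x i) (j : I) : M.tryProb x i j ≤ 1 := by
  rw [← h.sum_tryProb hS]
  exact Finset.single_le_sum (fun k _ => h.tryProb_nonneg hx i k) (Finset.mem_univ j)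

theorem demand_nonneg (h : M.IsHomogeneous q r) {x : I → ℝ} (hx : ∀ j, 0 ≤ x j) (j : I) :
    0 ≤ M.demand x j :=
  Finset.sum_nonneg fun i _ => mul_nonneg (M.w_pos i).le (h.tryProb_nonneg hx i j)

theorem demand_pos (h : M.IsHomogeneous q r) {x : I → ℝ} (hx : ∀ j, 0 < x j) (j : I) :
    0 < M.demand x j := by
  obtain ⟨i, hi⟩ := h.seen j
  refine Finset.sum_pos' (fun i _ => mul_nonneg (M.w_pos i).le
    (h.tryProb_nonneg (fun j => (hx j).le) i j)) ⟨i, Finset.mem_univ i, mul_pos (M.w_pos i) ?_⟩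
  rw [h.tryProb_eq]
  exact div_pos (mul_pos hi (Real.rpow_pos_of_pos (hx j) r)) (h.attraction_pos hx i)

theorem sum_demand (h : M.IsHomogeneous q r) {x : I → ℝ} (hS : ∀ i, 0 < M.attraction r x i) :
    ∑ j, M.demand x j = 1 := by
  simp_rw [demand]
  rw [Finset.sum_comm]
  simp_rw [← Finset.mul_sum, h.sum_tryProb (hS _), mul_one, M.w_sum]

theorem spending_eq (h : M.IsHomogeneous q r) (x : I → ℝ) (i : U) (j : I) :
    M.spending x i j = q j * (M.w i * M.tryProb x i j) := by
  rw [spending, h.q_eq]; ring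

theorem buyProb_eq (h : M.IsHomogeneous q r) (x : I → ℝ) (j : I) :
    M.buyProb x j = q j * M.demand x j := by
  simp_rw [buyProb, h.spending_eq, demand, Finset.mul_sum]

theorem attraction_mul (_h : M.IsHomogeneous q r) {x : I → ℝ} (hx : ∀ j, 0 ≤ x j) {c : ℝ}
    (hc : 0 < c) (i : U) :
    M.attraction r (fun j => c * x j) i = c ^ r * M.attraction r x i := by
  simp_rw [attraction, Finset.mul_sum]
  refine Finset.sum_congr rfl fun k _ => ?_
  rw [Real.mul_rpow hc.le (hx k)]; ring

theorem tryProb_mul (h : M.IsHomogeneous q r) {x : I → ℝ} (hx : ∀ j, 0 ≤ x j) {c : ℝ}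
    (hc : 0 < c) : M.tryProb (fun j => c * x j) = M.tryProb x := by
  ext i j
  rw [h.tryProb_eq, h.tryProb_eq, h.attraction_mul hx hc, Real.mul_rpow hc.le (hx j),
    mul_left_comm, mul_div_mul_left _ _ (Real.rpow_pos_of_pos hc r).ne']

theorem potential_mul (h : M.IsHomogeneous q r) {x : I → ℝ} (hx : ∀ j, 0 ≤ x j)
    (hS : ∀ i, 0 < M.attraction r x i) {c : ℝ} (hc : 0 < c) :
    M.potential r (fun j => c * x j) = r * Real.log c + M.potential r x := by
  simp_rw [potential, h.attraction_mul hx hc,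
    Real.log_mul (Real.rpow_pos_of_pos hc r).ne' (hS _).ne', Real.log_rpow hc, mul_add,
    Finset.sum_add_distrib, ← Finset.sum_mul, M.w_sum, one_mul]

theorem spending_mem_feasible (h : M.IsHomogeneous q r) {x : I → ℝ} (hx : ∀ j, 0 ≤ x j)
    (hS : ∀ i, 0 < M.attraction r x i) : M.spending x ∈ feasible M.w q := by
  refine ⟨fun i => ?_, fun i j => ?_⟩
  · simp_rw [h.spending_eq, mul_div_cancel_left₀ _ (h.q_pos _).ne', ← Finset.mul_sum,
      h.sum_tryProb (hS i), mul_one]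
  · rw [h.spending_eq]
    exact mul_nonneg (h.q_pos j).le (mul_nonneg (M.w_pos i).le (h.tryProb_nonneg hx i j))

theorem spending_eq_zero (h : M.IsHomogeneous q r) (x : I → ℝ) (i : U) (j : I)
    (hv : M.v i j = 0) : M.spending x i j = 0 := by
  rw [h.spending_eq, h.tryProb_eq, hv]; simp

/-- The objective at the spendings of a point. -/
theorem gammaVal_spending (h : M.IsHomogeneous q r) {x : I → ℝ} (hx : ∀ j, 0 ≤ x j)
    (hS : ∀ i, 0 < M.attraction r x i) (hx0 : ∀ i j, x j = 0 → M.tryProb x i j = 0) :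
    gammaVal r M.v q (M.spending x) = M.potential r x - ∑ i, M.w i * Real.log (M.w i)
      + r * ∑ j, M.demand x j * Real.log (q j * M.demand x j / x j) := by
  have key : ∀ i, ∑ j, M.spending x i j / q j * Real.log (M.spending x i j / (q j * M.v i j))
      = r * ∑ j, M.w i * M.tryProb x i j * Real.log (x j)
        + M.w i * Real.log (M.w i) - M.w i * Real.log (M.attraction r x i) := by
    intro i
    have : ∀ j, M.spending x i j / q j * Real.log (M.spending x i j / (q j * M.v i j))
        = r * (M.w i * M.tryProb x i j * Real.log (x j))
          + (M.w i * Real.log (M.w i) - M.w i * Real.log (M.attraction r x i))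
            * M.tryProb x i j := by
      intro j
      rw [h.spending_eq, mul_div_cancel_left₀ _ (h.q_pos _).ne',
        mul_div_mul_left _ _ (h.q_pos _).ne']
      rcases eq_or_ne (M.tryProb x i j) 0 with h0 | h0
      · simp [h0]
      have hxj : 0 < x j := (hx j).lt_of_ne fun e => h0 (hx0 i j e.symm)
      have hv : M.v i j ≠ 0 := by
        intro e
        apply h0
        rw [h.tryProb_eq, e]; simp
      -- The visibility cancels, so the logarithm splits into an item part r log x_j and a part
      -- depending only on the type.
      have e : M.w i * M.tryProb x i j / M.v i j = M.w i * x j ^ r / M.attraction r x i := by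
        rw [h.tryProb_eq]; field_simp
      have hp := Real.rpow_pos_of_pos hxj r
      rw [e, Real.log_div (mul_pos (M.w_pos i) hp).ne' (hS i).ne',
        Real.log_mul (M.w_pos i).ne' hp.ne', Real.log_rpow hxj]
      ring
    simp_rw [this, Finset.sum_add_distrib, ← Finset.mul_sum, h.sum_tryProb (hS i)]
    ring
  have e1 : ∀ j, M.demand x j * Real.log (q j * M.demand x j / x j)
      = M.demand x j * Real.log (q j * M.demand x j) - M.demand x j * Real.log (x j) := by
    intro j
    rcases (hx j).eq_or_lt with e | e
    · have : M.demand x j = 0 := by simp [demand, hx0 _ j e.symm]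
      simp [this]
    rcases eq_or_ne (M.demand x j) 0 with h0 | h0
    · simp [h0]
    rw [Real.log_div (mul_ne_zero (h.q_pos j).ne' h0) e.ne']
    ring
  have e2 : ∑ i, ∑ j, M.w i * M.tryProb x i j * Real.log (x j)
      = ∑ j, M.demand x j * Real.log (x j) := by
    rw [Finset.sum_comm]
    simp_rw [demand, Finset.sum_mul]
  have e3 : ∀ j, ∑ i, M.spending x i j = q j * M.demand x j := fun j => h.buyProb_eq x j
  simp_rw [gammaVal, key, e3, mul_div_cancel_left₀ _ (h.q_pos _).ne', Finset.sum_sub_distrib,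
    Finset.sum_add_distrib, ← Finset.mul_sum, e2, e1, Finset.sum_sub_distrib, potential]
  ring

theorem attraction_sum_pos (h : M.IsHomogeneous q r) {b : U → I → ℝ} (hb : b ∈ feasible M.w q)
    (hb0 : ∀ i j, M.v i j = 0 → b i j = 0) (i : U) :
    0 < M.attraction r (fun j => ∑ i, b i j) i := by
  obtain ⟨j, hj⟩ : ∃ j, 0 < b i j := by
    by_contra! hc
    have : ∀ j, b i j = 0 := fun j => le_antisymm (hc j) (hb.2 i j)
    have h1 := hb.1 i
    simp only [this, zero_div, Finset.sum_const_zero] at h1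
    exact (M.w_pos i).ne h1
  refine h.attraction_pos_of (fun j => Finset.sum_nonneg fun i _ => hb.2 i j) (j := j)
    ((M.v_nonneg i j).lt_of_ne fun e => hj.ne' (hb0 i j e.symm)) ?_
  exact Finset.sum_pos' (fun i _ => hb.2 i j) ⟨i, Finset.mem_univ i, hj⟩

theorem sum_mem_qualitySimplex {b : U → I → ℝ}
    (hb : b ∈ feasible M.w q) : (fun j => ∑ i, b i j) ∈ qualitySimplex q := by
  refine ⟨fun j => Finset.sum_nonneg fun i _ => hb.2 i j, ?_⟩
  simp_rw [Finset.sum_div]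
  rw [Finset.sum_comm]
  simp_rw [hb.1, M.w_sum]

/-- The objective is bounded by the potential of the total spendings. -/
theorem gammaVal_le (h : M.IsHomogeneous q r) {b : U → I → ℝ} (hb : b ∈ feasible M.w q)
    (hb0 : ∀ i j, M.v i j = 0 → b i j = 0) :
    gammaVal r M.v q b
      ≤ M.potential r (fun j => ∑ i, b i j) - ∑ i, M.w i * Real.log (M.w i) := by
  set z : I → ℝ := fun j => ∑ i, b i j with hz
  have hz0 : ∀ j, 0 ≤ z j := fun j => Finset.sum_nonneg fun i _ => hb.2 i j
  have hS := h.attraction_sum_pos hb hb0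
  have e : gammaVal r M.v q b
      = ∑ i, ∑ j, b i j / q j * (r * Real.log (z j) - Real.log (b i j / (q j * M.v i j))) := by
    have e1 : r * ∑ j, z j / q j * Real.log (z j)
        = ∑ i, ∑ j, b i j / q j * (r * Real.log (z j)) := by
      rw [Finset.sum_comm, Finset.mul_sum]
      refine Finset.sum_congr rfl fun j _ => ?_
      rw [← Finset.sum_mul, ← Finset.sum_div]
      ring
    simp_rw [gammaVal, mul_sub, Finset.sum_sub_distrib, ← e1]
    rfl
  rw [e, potential, ← Finset.sum_sub_distrib]
  refine Finset.sum_le_sum fun i _ => ?_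
  -- Gibbs' inequality compares b_ij / q_j with w_i times the trial probabilities at the total
  -- spendings z. Both have total w_i over j, so the linear terms cancel in the sum.
  have key : ∀ j, b i j / q j * (r * Real.log (z j) - Real.log (b i j / (q j * M.v i j)))
      ≤ b i j / q j * (Real.log (M.attraction r z i) - Real.log (M.w i))
        + (M.w i * M.tryProb z i j - b i j / q j) := by
    intro j
    have hq := h.q_pos j
    rcases (hb.2 i j).eq_or_lt with h0 | h0
    · simp only [← h0, zero_div, zero_mul, sub_zero, zero_add]
      exact mul_nonneg (M.w_pos i).le (h.tryProb_nonneg hz0 i j)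
    have hv : 0 < M.v i j := (M.v_nonneg i j).lt_of_ne fun e => h0.ne' (hb0 i j e.symm)
    have hzj : 0 < z j := Finset.sum_pos' (fun i _ => hb.2 i j) ⟨i, Finset.mem_univ i, h0⟩
    have hp := Real.rpow_pos_of_pos hzj r
    have hT : 0 < M.w i * M.tryProb z i j := by
      rw [h.tryProb_eq]
      exact mul_pos (M.w_pos i) (div_pos (mul_pos hv hp) (hS i))
    have hs : 0 < b i j / q j := div_pos h0 hq
    have h1 := sub_le_mul_log_div hs.le hT.le fun e => absurd e hT.ne'
    have e2 : Real.log (b i j / q j / (M.w i * M.tryProb z i j))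
        = Real.log (b i j / (q j * M.v i j)) - r * Real.log (z j)
          + Real.log (M.attraction r z i) - Real.log (M.w i) := by
      rw [h.tryProb_eq, Real.log_div hs.ne' (by rw [← h.tryProb_eq]; exact hT.ne'),
        Real.log_mul (M.w_pos i).ne' (div_pos (mul_pos hv hp) (hS i)).ne',
        Real.log_div (mul_pos hv hp).ne' (hS i).ne', Real.log_mul hv.ne' hp.ne',
        Real.log_rpow hzj, ← div_div, Real.log_div hs.ne' hv.ne']
      ring
    rw [e2] at h1
    linarith
  refine (Finset.sum_le_sum fun j _ => key j).trans (le_of_eq ?_)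
  rw [Finset.sum_add_distrib, ← Finset.sum_mul, Finset.sum_sub_distrib, ← Finset.mul_sum,
    h.sum_tryProb (hS i), hb.1 i]
  ring

theorem isCompact_qualitySimplex (h : M.IsHomogeneous q r) : IsCompact (qualitySimplex q) := by
  have hcl : IsClosed (qualitySimplex q) := by
    have : qualitySimplex q = (⋂ j, {x | 0 ≤ x j}) ∩ {x | ∑ j, x j / q j = 1} := by
      ext x; simp [qualitySimplex]
    rw [this]
    refine (isClosed_iInter fun j => isClosed_le (by fun_prop) (by fun_prop)).inter
      (isClosed_eq (by fun_prop) (by fun_prop))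
  refine (isCompact_Icc (a := (0 : I → ℝ)) (b := q)).of_isClosed_subset hcl ?_
  rintro x ⟨hx, hs⟩
  refine ⟨fun j => hx j, fun j => ?_⟩
  rw [← div_le_one (h.q_pos j), ← hs]
  exact Finset.single_le_sum (f := fun j => x j / q j)
    (fun k _ => div_nonneg (hx k) (h.q_pos k).le) (Finset.mem_univ j)

theorem exists_pos_mem_qualitySimplex (h : M.IsHomogeneous q r) :
    ∃ x ∈ qualitySimplex q, ∀ j, 0 < x j := by
  have := h.nonempty.1
  have hc : (0 : ℝ) < Fintype.card I := by exact_mod_cast Fintype.card_pos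
  have hp : ∀ j, 0 < q j / Fintype.card I := fun j => div_pos (h.q_pos j) hc
  refine ⟨fun j => q j / Fintype.card I, ⟨fun j => (hp j).le, ?_⟩, hp⟩
  have : ∀ j, q j / Fintype.card I / q j = 1 / Fintype.card I := fun j => by
    have := (h.q_pos j).ne'
    field_simp
  simp_rw [this]
  simp [hc.ne']

/-- The potential has a maximiser on the simplex. -/
theorem exists_isMax_potential (h : M.IsHomogeneous q r) :
    ∃ z ∈ qualitySimplex q, (∀ i, 0 < M.attraction r z i) ∧
      ∀ x ∈ qualitySimplex q, (∀ i, 0 < M.attraction r x i) →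
        M.potential r x ≤ M.potential r z := by
  obtain ⟨x₀, hx₀, hx₀p⟩ := h.exists_pos_mem_qualitySimplex
  -- The product is exp Φ where all attractions are positive. Unlike Φ it stays continuous where an
  -- attraction vanishes, and its value there is 0, so compactness applies and such points are never
  -- maximal.
  have hcont : Continuous fun x => ∏ i, M.attraction r x i ^ M.w i := by
    refine continuous_finsetProd _ fun i _ => ?_
    refine Continuous.rpow_const ?_ fun x => Or.inr (M.w_pos i).le
    refine continuous_finsetSum _ fun k _ => continuous_const.mul ?_
    exact (continuous_apply k).rpow_const fun x => Or.inr h.r_nonneg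
  obtain ⟨z, hz, hmax⟩ := h.isCompact_qualitySimplex.exists_isMaxOn ⟨x₀, hx₀⟩ hcont.continuousOn
  have hlog : ∀ x, (∀ i, 0 < M.attraction r x i) →
      Real.log (∏ i, M.attraction r x i ^ M.w i) = M.potential r x := by
    intro x hx
    rw [Real.log_prod fun i _ => (Real.rpow_pos_of_pos (hx i) _).ne']
    exact Finset.sum_congr rfl fun i _ => Real.log_rpow (hx i) _
  have hpos : ∀ x, (∀ i, 0 < M.attraction r x i) → 0 < ∏ i, M.attraction r x i ^ M.w i :=
    fun x hx => Finset.prod_pos fun i _ => Real.rpow_pos_of_pos (hx i) _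
  have hzS : ∀ i, 0 < M.attraction r z i := by
    intro i
    refine (M.attraction_nonneg r hz.1 i).lt_of_ne fun e => ?_
    have h1 := (hpos x₀ (h.attraction_pos hx₀p)).trans_le (hmax hx₀)
    have h2 : ∏ i, M.attraction r z i ^ M.w i = 0 :=
      Finset.prod_eq_zero (Finset.mem_univ i) (by rw [← e, Real.zero_rpow (M.w_pos i).ne'])
    exact h1.ne' h2
  refine ⟨z, hz, hzS, fun x hx hxS => ?_⟩
  rw [← hlog x hxS, ← hlog z hzS]
  exact Real.log_le_log (hpos x hxS) (hmax hx)

end IsHomogeneous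

end TrialOfferMarket

/-! ### Relative entropy, fixed points and drift inequalities -/

namespace TrialOfferMarket

variable {U I : Type*} [Fintype U] [Fintype I]

/-- The relative entropy of the quality-weighted vectors `z` and `x`. -/
noncomputable def entropyGap (q z x : I → ℝ) : ℝ := ∑ j, z j / q j * Real.log (z j / x j)

/-- The one-term bounds are summed; the linear terms cancel since both vectors lie in the simplex.
This Hellinger bound supplies both the equality case of Gibbs' inequality and convergence from
vanishing entropy. -/
theorem sum_sq_sqrt_le_entropyGap {q z x : I → ℝ} (hq : ∀ j, 0 < q j)
    (hz : z ∈ qualitySimplex q) (hx : x ∈ qualitySimplex q) (h0 : ∀ j, x j = 0 → z j = 0) :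
    ∑ j, (√(z j / q j) - √(x j / q j)) ^ 2 ≤ entropyGap q z x := by
  have key : ∀ j, (√(z j / q j) - √(x j / q j)) ^ 2 + (z j / q j - x j / q j)
      ≤ z j / q j * Real.log (z j / x j) := by
    intro j
    have := sq_sqrt_sub_sqrt_add_sub_le_mul_log_div (div_nonneg (hz.1 j) (hq j).le)
      (div_nonneg (hx.1 j) (hq j).le) (fun e => by
        rw [div_eq_zero_iff, or_iff_left (hq j).ne'] at e ⊢
        exact h0 j e)
    rwa [div_div_div_cancel_right₀ (hq j).ne'] at this
  have := Finset.sum_le_sum fun j (_ : j ∈ Finset.univ) => key j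
  rw [Finset.sum_add_distrib, Finset.sum_sub_distrib, hz.2, hx.2] at this
  simpa [entropyGap] using this

theorem entropyGap_nonneg {q z x : I → ℝ} (hq : ∀ j, 0 < q j)
    (hz : z ∈ qualitySimplex q) (hx : x ∈ qualitySimplex q) (h0 : ∀ j, x j = 0 → z j = 0) :
    0 ≤ entropyGap q z x :=
  (Finset.sum_nonneg fun _ _ => sq_nonneg _).trans (sum_sq_sqrt_le_entropyGap hq hz hx h0)

theorem eq_of_entropyGap_nonpos {q z x : I → ℝ} (hq : ∀ j, 0 < q j)
    (hz : z ∈ qualitySimplex q) (hx : x ∈ qualitySimplex q) (h0 : ∀ j, x j = 0 → z j = 0)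
    (hle : entropyGap q z x ≤ 0) : z = x := by
  have h1 := (Finset.sum_eq_zero_iff_of_nonneg fun j _ => sq_nonneg _).1
    (le_antisymm ((sum_sq_sqrt_le_entropyGap hq hz hx h0).trans hle)
      (Finset.sum_nonneg fun j _ => sq_nonneg (√(z j / q j) - √(x j / q j))))
  ext j
  have h2 := sub_eq_zero.1 (pow_eq_zero_iff two_ne_zero |>.1 (h1 j (Finset.mem_univ j)))
  have h3 := (Real.sqrt_inj (div_nonneg (hz.1 j) (hq j).le) (div_nonneg (hx.1 j) (hq j).le)).1 h2
  have := (hq j).ne'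
  field_simp at h3
  exact h3

/-- Convergence in relative entropy implies convergence. -/
theorem tendsto_of_entropyGap_tendsto_zero {q z : I → ℝ} {x : ℕ → I → ℝ} (hq : ∀ j, 0 < q j)
    (hz : z ∈ qualitySimplex q) (hx : ∀ t, x t ∈ qualitySimplex q) (hpos : ∀ t j, 0 < x t j)
    (hlim : Tendsto (fun t => entropyGap q z (x t)) atTop (𝓝 0)) : Tendsto x atTop (𝓝 z) := by
  refine tendsto_pi_nhds.2 fun j => ?_
  have h1 : Tendsto (fun t => (√(x t j / q j) - √(z j / q j)) ^ 2) atTop (𝓝 0) := by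
    refine squeeze_zero (fun t => sq_nonneg _) (fun t => ?_) hlim
    refine le_trans ?_ (sum_sq_sqrt_le_entropyGap hq hz (hx t) fun k e => absurd e (hpos t k).ne')
    rw [sub_sq_comm]
    exact Finset.single_le_sum (f := fun j => (√(z j / q j) - √(x t j / q j)) ^ 2)
      (fun k _ => sq_nonneg _) (Finset.mem_univ j)
  have h2 : Tendsto (fun t => |√(x t j / q j) - √(z j / q j)|) atTop (𝓝 0) := by
    have := h1.sqrt
    simpa [Real.sqrt_sq_eq_abs] using this
  have h3 : Tendsto (fun t => √(x t j / q j)) atTop (𝓝 √(z j / q j)) :=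
    tendsto_iff_norm_sub_tendsto_zero.2 h2
  have h4 := (h3.pow 2).mul_const (q j)
  rw [Real.sq_sqrt (div_nonneg (hz.1 j) (hq j).le), div_mul_cancel₀ _ (hq j).ne'] at h4
  refine h4.congr fun t => ?_
  rw [Real.sq_sqrt (div_nonneg ((hx t).1 j) (hq j).le), div_mul_cancel₀ _ (hq j).ne']

namespace IsHomogeneous

variable {M : TrialOfferMarket U I} {q : I → ℝ} {r : ℝ}

/-- Dividing by q_j turns purchase probabilities back into trial probabilities, whose total is 1.
This is the reason for the weights 1 / q_j in the simplex. -/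
theorem buyProb_mem_qualitySimplex (h : M.IsHomogeneous q r) {x : I → ℝ} (hx : ∀ j, 0 ≤ x j)
    (hS : ∀ i, 0 < M.attraction r x i) : M.buyProb x ∈ qualitySimplex q := by
  refine ⟨fun j => ?_, ?_⟩
  · rw [h.buyProb_eq]
    exact mul_nonneg (h.q_pos j).le (h.demand_nonneg hx j)
  · simp_rw [h.buyProb_eq, mul_div_cancel_left₀ _ (h.q_pos _).ne', h.sum_demand hS]

theorem buyProb_div (h : M.IsHomogeneous q r) (x : I → ℝ) (j : I) :
    M.buyProb x j / q j = M.demand x j := by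
  rw [h.buyProb_eq, mul_div_cancel_left₀ _ (h.q_pos _).ne']

theorem buyProb_mul (h : M.IsHomogeneous q r) {x : I → ℝ} (hx : ∀ j, 0 ≤ x j) {c : ℝ}
    (hc : 0 < c) : M.buyProb (fun j => c * x j) = M.buyProb x := by
  ext j
  simp_rw [h.buyProb_eq, demand, h.tryProb_mul hx hc]

theorem gammaVal_spending' (h : M.IsHomogeneous q r) {x : I → ℝ} (hx : ∀ j, 0 ≤ x j)
    (hS : ∀ i, 0 < M.attraction r x i) (hx0 : ∀ i j, x j = 0 → M.tryProb x i j = 0) :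
    gammaVal r M.v q (M.spending x) = M.potential r x - ∑ i, M.w i * Real.log (M.w i)
      + r * entropyGap q (M.buyProb x) x := by
  rw [h.gammaVal_spending hx hS hx0]
  simp_rw [entropyGap, h.buyProb_div, h.buyProb_eq]

theorem buyProb_eq_zero (h : M.IsHomogeneous q r) {x : I → ℝ}
    (hx0 : ∀ i j, x j = 0 → M.tryProb x i j = 0) (j : I) (hj : x j = 0) : M.buyProb x j = 0 := by
  simp [h.buyProb_eq, demand, hx0 _ j hj]

theorem le_gammaVal_spending (h : M.IsHomogeneous q r) {x : I → ℝ} (hx : x ∈ qualitySimplex q)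
    (hS : ∀ i, 0 < M.attraction r x i) (hx0 : ∀ i j, x j = 0 → M.tryProb x i j = 0) :
    M.potential r x - ∑ i, M.w i * Real.log (M.w i) ≤ gammaVal r M.v q (M.spending x) := by
  rw [h.gammaVal_spending' hx.1 hS hx0]
  have := mul_nonneg h.r_nonneg (entropyGap_nonneg h.q_pos
    (h.buyProb_mem_qualitySimplex hx.1 hS) hx (h.buyProb_eq_zero hx0))
  linarith

/-- A maximiser of the potential is a fixed point of the demand. -/
theorem buyProb_eq_self_of_isMax (h : M.IsHomogeneous q r) (hr : 0 < r) {z : I → ℝ}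
    (hz : z ∈ qualitySimplex q) (hS : ∀ i, 0 < M.attraction r z i)
    (hz0 : ∀ i j, z j = 0 → M.tryProb z i j = 0)
    (hmax : ∀ x ∈ qualitySimplex q, (∀ i, 0 < M.attraction r x i) →
        M.potential r x ≤ M.potential r z) : M.buyProb z = z := by
  have hf := h.spending_mem_feasible hz.1 hS
  have hb0 := h.spending_eq_zero z
  -- The spendings at z have column sums y(z), so up to one constant Φ(z) + r KL(y(z) | z) = Γ ≤
  -- Φ(y(z)) ≤ Φ(z). This forces the entropy to vanish.
  have h1 := h.gammaVal_le hf hb0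
  have h2 := hmax _ (sum_mem_qualitySimplex hf) (h.attraction_sum_pos hf hb0)
  rw [h.gammaVal_spending' hz.1 hS hz0] at h1
  refine eq_of_entropyGap_nonpos h.q_pos (h.buyProb_mem_qualitySimplex hz.1 hS) hz
    (h.buyProb_eq_zero hz0) ?_
  by_contra! hc
  have := mul_pos hr hc
  linarith

/-- For `0 < r < 1` the maximisers of the potential are interior. -/
theorem pos_of_isMax (h : M.IsHomogeneous q r) (hr : 0 < r) (hr1 : r < 1) {z : I → ℝ}
    (hz : z ∈ qualitySimplex q) (hS : ∀ i, 0 < M.attraction r z i)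
    (hmax : ∀ x ∈ qualitySimplex q, (∀ i, 0 < M.attraction r x i) →
        M.potential r x ≤ M.potential r z) (j : I) : 0 < z j := by
  classical
  refine (hz.1 j).lt_of_ne fun hzj => ?_
  obtain ⟨i, hi⟩ := h.seen j
  have hq := h.q_pos j
  have hw := M.w_pos i
  -- Raise the zero coordinate j to ε and rescale back into the simplex. The potential gains at
  -- least w_i v_ij ε^r / (S_i + v_ij ε^r), with S_i the attraction at z, and loses at most r ε /
  -- q_j; maximality and division by ε^r give the bound, whose right side tends to 0.
  have key : ∀ ε : ℝ, 0 < ε →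
      M.w i * M.v i j ≤ r / q j * (ε ^ (1 - r) * (M.attraction r z i + M.v i j * ε ^ r)) := by
    intro ε hε
    set x := Function.update z j ε with hx
    have hx0 : ∀ k, 0 ≤ x k := fun k => by
      rcases eq_or_ne k j with rfl | hk
      · simp [hx, hε.le]
      · simp [hx, hk, hz.1 k]
    have hatt : ∀ l, M.attraction r x l = M.attraction r z l + M.v l j * ε ^ r := by
      intro l
      have : ∀ k, M.v l k * x k ^ r
          = M.v l k * z k ^ r + if k = j then M.v l j * ε ^ r else 0 := by
        intro k
        rcases eq_or_ne k j with rfl | hk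
        · simp [hx, ← hzj, Real.zero_rpow hr.ne']
        · simp [hx, hk]
      simp_rw [attraction, this, Finset.sum_add_distrib]
      simp
    have hp := Real.rpow_pos_of_pos hε r
    have hge : ∀ l, M.attraction r z l ≤ M.attraction r x l := fun l => by
      rw [hatt]; linarith [mul_nonneg (M.v_nonneg l j) hp.le]
    have hSx : ∀ l, 0 < M.attraction r x l := fun l => (hS l).trans_le (hge l)
    have hsum : ∑ k, x k / q k = 1 + ε / q j := by
      have : ∀ k, x k / q k = z k / q k + if k = j then ε / q j else 0 := by
        intro k
        rcases eq_or_ne k j with rfl | hk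
        · simp [hx, ← hzj]
        · simp [hx, hk]
      simp_rw [this, Finset.sum_add_distrib, hz.2]
      simp
    have hc : 0 < 1 + ε / q j := by positivity
    have hmem : (fun k => (1 + ε / q j)⁻¹ * x k) ∈ qualitySimplex q := by
      refine ⟨fun k => mul_nonneg (inv_pos.2 hc).le (hx0 k), ?_⟩
      simp_rw [mul_div_assoc, ← Finset.mul_sum, hsum]
      exact inv_mul_cancel₀ hc.ne'
    have h1 := hmax _ hmem fun l => by
      rw [h.attraction_mul hx0 (inv_pos.2 hc)]
      exact mul_pos (Real.rpow_pos_of_pos (inv_pos.2 hc) r) (hSx l)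
    rw [h.potential_mul hx0 hSx (inv_pos.2 hc), Real.log_inv] at h1
    have h2 : M.potential r z + M.w i * (M.v i j * ε ^ r / (M.attraction r z i + M.v i j * ε ^ r))
        ≤ M.potential r x := by
      rw [← sub_nonneg, add_comm, ← sub_sub, sub_right_comm, sub_nonneg, potential, potential,
        ← Finset.sum_sub_distrib]
      refine le_trans ?_ (Finset.single_le_sum (fun l _ => ?_) (Finset.mem_univ i))
      · rw [← mul_sub, ← Real.log_div (hSx i).ne' (hS i).ne']
        refine mul_le_mul_of_nonneg_left ?_ hw.le
        refine le_trans (le_of_eq ?_)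
          (Real.one_sub_inv_le_log_of_pos (div_pos (hSx i) (hS i)))
        have := (hatt i ▸ hSx i).ne'
        rw [hatt, inv_div, eq_sub_iff_add_eq, ← add_div, add_comm, div_self this]
      · rw [← mul_sub]
        exact mul_nonneg (M.w_pos l).le (sub_nonneg.2 (Real.log_le_log (hS l) (hge l)))
    have h3 : r * Real.log (1 + ε / q j) ≤ r * (ε / q j) :=
      mul_le_mul_of_nonneg_left (by linarith [Real.log_le_sub_one_of_pos hc]) hr.le
    have hA : 0 < M.attraction r z i + M.v i j * ε ^ r := hatt i ▸ hSx i
    have h4 : M.w i * (M.v i j * ε ^ r / (M.attraction r z i + M.v i j * ε ^ r))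
        ≤ r * (ε / q j) := by linarith
    rw [← mul_div_assoc, div_le_iff₀ hA] at h4
    have h5 : ε = ε ^ (1 - r) * ε ^ r := by rw [← Real.rpow_add hε]; simp
    refine le_of_mul_le_mul_right ?_ hp
    calc M.w i * M.v i j * ε ^ r = M.w i * (M.v i j * ε ^ r) := by ring
      _ ≤ _ := h4
      _ = r * (ε ^ (1 - r) * ε ^ r / q j) * (M.attraction r z i + M.v i j * ε ^ r) := by
        rw [← h5]
      _ = _ := by ring
  have hlim : Tendsto (fun ε : ℝ =>
      r / q j * (ε ^ (1 - r) * (M.attraction r z i + M.v i j * ε ^ r))) (𝓝[>] 0) (𝓝 0) := by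
    have hc : Continuous fun ε : ℝ =>
        r / q j * (ε ^ (1 - r) * (M.attraction r z i + M.v i j * ε ^ r)) := by
      have c1 : Continuous fun ε : ℝ => ε ^ (1 - r) :=
        continuous_id.rpow_const fun _ => Or.inr (by linarith)
      have c2 : Continuous fun ε : ℝ => ε ^ r :=
        continuous_id.rpow_const fun _ => Or.inr hr.le
      fun_prop
    have := hc.tendsto 0
    rw [Real.zero_rpow (by linarith), zero_mul, mul_zero] at this
    exact this.mono_left nhdsWithin_le_nhds
  have := ge_of_tendsto hlim (eventually_nhdsWithin_of_forall fun ε hε => key ε hε)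
  exact absurd this (not_le.2 (mul_pos hw hi))

/-- Positivity of r matters: 0^0 = 1 would leave an item of share 0 its attraction. -/
theorem tryProb_eq_zero (h : M.IsHomogeneous q r) (hr : 0 < r) (x : I → ℝ) (i : U) (j : I)
    (hj : x j = 0) : M.tryProb x i j = 0 := by
  rw [h.tryProb_eq, hj, Real.zero_rpow hr.ne', mul_zero, zero_div]

/-- For `r < 1` there is an interior fixed point that maximises the potential. -/
theorem exists_fixedPoint (h : M.IsHomogeneous q r) (hr1 : r < 1) :
    ∃ z ∈ qualitySimplex q, (∀ j, 0 < z j) ∧ M.buyProb z = z ∧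
      ∀ x ∈ qualitySimplex q, (∀ i, 0 < M.attraction r x i) →
        M.potential r x ≤ M.potential r z := by
  rcases h.r_nonneg.eq_or_lt with hr | hr
  -- For r = 0 the potential is constant, so being a maximiser says nothing; but `buyProb` is
  -- constant too, and its value is the fixed point.
  · have hatt : ∀ x y : I → ℝ, M.attraction r x = M.attraction r y := by
      intro x y; ext i; simp [attraction, ← hr]
    have hbuy : ∀ x y : I → ℝ, M.buyProb x = M.buyProb y := by
      intro x y; ext j
      simp_rw [h.buyProb_eq, demand, h.tryProb_eq, hatt x y, ← hr, Real.rpow_zero]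
    obtain ⟨x₀, hx₀, hx₀p⟩ := h.exists_pos_mem_qualitySimplex
    refine ⟨M.buyProb x₀, h.buyProb_mem_qualitySimplex hx₀.1 (h.attraction_pos hx₀p), fun j => ?_,
      hbuy _ _, fun x _ _ => ?_⟩
    · rw [h.buyProb_eq]
      exact mul_pos (h.q_pos j) (h.demand_pos hx₀p j)
    · rw [potential, potential, hatt x]
  · obtain ⟨z, hz, hS, hmax⟩ := h.exists_isMax_potential
    exact ⟨z, hz, h.pos_of_isMax hr hr1 hz hS hmax,
      h.buyProb_eq_self_of_isMax hr hz hS (h.tryProb_eq_zero hr z) hmax, hmax⟩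

/-- The drift inequality at an interior fixed point. -/
theorem drift_of_fixedPoint (h : M.IsHomogeneous q r) {z x : I → ℝ} (hz : ∀ j, 0 < z j)
    (hfix : M.buyProb z = z) (hx : ∀ j, 0 < x j) :
    1 + (M.potential r z - M.potential r x) + (1 - r) * entropyGap q z x
      ≤ ∑ j, z j / q j * (M.buyProb x j / x j) := by
  have hSz := h.attraction_pos hz
  have hSx := h.attraction_pos hx
  have e1 : ∑ j, z j / q j * (M.buyProb x j / x j)
      = ∑ i, M.w i * ∑ j, M.tryProb x i j * (z j / x j) := by
    simp_rw [h.buyProb_eq, demand, Finset.mul_sum]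
    rw [Finset.sum_comm]
    refine Finset.sum_congr rfl fun j _ => ?_
    rw [Finset.sum_div, Finset.mul_sum]
    refine Finset.sum_congr rfl fun i _ => ?_
    have := (h.q_pos j).ne'
    field_simp
  have e2 : ∀ j, z j / q j = M.demand z j := fun j => by rw [← h.buyProb_div, hfix]
  have e3 : entropyGap q z x = ∑ i, M.w i * ∑ j, M.tryProb z i j * Real.log (z j / x j) := by
    simp_rw [entropyGap, e2, demand, Finset.sum_mul, Finset.mul_sum]
    rw [Finset.sum_comm]
    simp_rw [mul_assoc]
  have e4 : (1 : ℝ) + (M.potential r z - M.potential r x) = ∑ i, M.w i *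
      (1 + (Real.log (M.attraction r z i) - Real.log (M.attraction r x i))) := by
    simp_rw [mul_add, mul_sub, Finset.sum_add_distrib, Finset.sum_sub_distrib, mul_one, M.w_sum,
      potential]
  rw [e1, e3, e4, Finset.mul_sum, ← Finset.sum_add_distrib]
  refine Finset.sum_le_sum fun i _ => ?_
  rw [mul_left_comm, ← mul_add]
  refine mul_le_mul_of_nonneg_left ?_ (M.w_pos i).le
  -- The trial probability at x times z_j / x_j equals the one at z times m = (z_j / x_j)^(1-r)
  -- S_i(z) / S_i(x), where S_i is the attraction; then m ≥ 1 + log m.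
  have key : ∀ j, M.tryProb z i j * (1 + ((1 - r) * Real.log (z j / x j)
        + (Real.log (M.attraction r z i) - Real.log (M.attraction r x i))))
      ≤ M.tryProb x i j * (z j / x j) := by
    intro j
    have hρ : 0 < z j / x j := div_pos (hz j) (hx j)
    have hm : 0 < (z j / x j) ^ (1 - r) * (M.attraction r z i / M.attraction r x i) :=
      mul_pos (Real.rpow_pos_of_pos hρ _) (div_pos (hSz i) (hSx i))
    have h1 := Real.log_le_sub_one_of_pos hm
    rw [Real.log_mul (Real.rpow_pos_of_pos hρ _).ne' (div_pos (hSz i) (hSx i)).ne',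
      Real.log_rpow hρ, Real.log_div (hSz i).ne' (hSx i).ne'] at h1
    have h2 : M.tryProb x i j * (z j / x j) = M.tryProb z i j *
        ((z j / x j) ^ (1 - r) * (M.attraction r z i / M.attraction r x i)) := by
      have := (hSz i).ne'
      have := (hSx i).ne'
      have := (Real.rpow_pos_of_pos (hz j) r).ne'
      have := (Real.rpow_pos_of_pos (hx j) r).ne'
      have := (hz j).ne'
      have := (hx j).ne'
      rw [h.tryProb_eq, h.tryProb_eq, Real.rpow_sub hρ, Real.rpow_one,
        Real.div_rpow (hz j).le (hx j).le]
      field_simp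
    rw [h2]
    exact mul_le_mul_of_nonneg_left (by linarith) (h.tryProb_nonneg (fun j => (hz j).le) i j)
  refine le_trans (le_of_eq ?_) (Finset.sum_le_sum fun j _ => key j)
  simp_rw [mul_add, Finset.sum_add_distrib, ← Finset.sum_mul, mul_one, h.sum_tryProb (hSz i),
    mul_left_comm _ (1 - r), ← Finset.mul_sum]
  ring

/-- The drift inequality for `r = 1`. -/
theorem drift_of_r_eq_one (h : M.IsHomogeneous q 1) {z x : I → ℝ}
    (hSz : ∀ i, 0 < M.attraction 1 z i) (hx : ∀ j, 0 < x j) :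
    1 + (M.potential 1 z - M.potential 1 x) ≤ ∑ j, z j / q j * (M.buyProb x j / x j) := by
  have hSx := h.attraction_pos hx
  -- For r = 1 attractions are linear, so this identity is exact and z may lie on the boundary and
  -- need not be a fixed point.
  have e1 : ∑ j, z j / q j * (M.buyProb x j / x j)
      = ∑ i, M.w i * (M.attraction 1 z i / M.attraction 1 x i) := by
    simp_rw [h.buyProb_eq, demand]
    have : ∀ i, M.w i * (M.attraction 1 z i / M.attraction 1 x i)
        = ∑ j, z j / x j * (M.w i * M.tryProb x i j) := by
      intro i
      simp_rw [h.tryProb_eq, Real.rpow_one]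
      nth_rw 1 [attraction]
      rw [Finset.sum_div, Finset.mul_sum]
      refine Finset.sum_congr rfl fun j _ => ?_
      have := (hx j).ne'
      rw [Real.rpow_one]
      field_simp
    simp_rw [this]
    rw [Finset.sum_comm]
    refine Finset.sum_congr rfl fun j _ => ?_
    rw [← Finset.mul_sum]
    have := (h.q_pos j).ne'
    field_simp
  have e4 : (1 : ℝ) + (M.potential 1 z - M.potential 1 x) = ∑ i, M.w i *
      (1 + (Real.log (M.attraction 1 z i) - Real.log (M.attraction 1 x i))) := by
    simp_rw [mul_add, mul_sub, Finset.sum_add_distrib, Finset.sum_sub_distrib, mul_one, M.w_sum,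
      potential]
  rw [e1, e4]
  refine Finset.sum_le_sum fun i _ => mul_le_mul_of_nonneg_left ?_ (M.w_pos i).le
  rw [← Real.log_div (hSz i).ne' (hSx i).ne']
  linarith [Real.log_le_sub_one_of_pos (div_pos (hSz i) (hSx i))]

/-- At fixed points the drift sums equal 1. Adding the drift inequalities for (z, x) and (x, z)
cancels the potentials and leaves a nonpositive multiple-of-(1 - r) sum of two entropies. -/
theorem fixedPoint_unique (h : M.IsHomogeneous q r) (hr1 : r < 1) {z x : I → ℝ}
    (hz : z ∈ qualitySimplex q) (hx : x ∈ qualitySimplex q) (hzp : ∀ j, 0 < z j)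
    (hxp : ∀ j, 0 < x j) (hzfix : M.buyProb z = z) (hxfix : M.buyProb x = x) : x = z := by
  have h1 := h.drift_of_fixedPoint hzp hzfix hxp
  have h2 := h.drift_of_fixedPoint hxp hxfix hzp
  simp only [hxfix, hzfix, div_self (hxp _).ne', div_self (hzp _).ne', mul_one, hz.2, hx.2]
    at h1 h2
  have h3 := entropyGap_nonneg h.q_pos hz hx fun j e => absurd e (hxp j).ne'
  refine eq_of_entropyGap_nonpos h.q_pos hx hz (fun j e => absurd e (hzp j).ne') ?_
  have h4 := mul_nonneg (sub_nonneg.2 hr1.le) h3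
  by_contra! hc
  have := mul_pos (sub_pos.2 hr1) hc
  linarith

end IsHomogeneous

end TrialOfferMarket

/-! ### The purchase process and its submartingales -/

namespace TrialOfferMarket

section Purchases

variable {U I : Type*} [Fintype U] [Fintype I] {Ω : Type*} (d₀ : I → ℕ) (X : ℕ → Ω → TrialOfferOutcome U I)

theorem purchases_zero (ω : Ω) : purchases d₀ X 0 ω = d₀ := by
  ext j; simp [purchases]

open Classical in
theorem purchases_succ (t : ℕ) (ω : Ω) (j : I) : purchases d₀ X (t + 1) ω j
    = purchases d₀ X t ω j + if ∃ i, X (t + 1) ω = (i, some (j, true)) then 1 else 0 := by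
  rw [purchases, ← Finset.insert_Icc_right_eq_Icc_add_one (by omega), Finset.filter_insert]
  split_ifs with h
  · rw [Finset.card_insert_of_notMem (by simp)]
    rfl
  · rfl

theorem le_purchases (t : ℕ) (ω : Ω) (j : I) : d₀ j ≤ purchases d₀ X t ω j :=
  Nat.le_add_right _ _

theorem purchases_le (t : ℕ) (ω : Ω) (j : I) : purchases d₀ X t ω j ≤ d₀ j + t := by
  classical
  refine Nat.add_le_add_left ((Finset.card_filter_le _ _).trans ?_) _
  simp

theorem purchases_mono (ω : Ω) (j : I) : Monotone fun t => purchases d₀ X t ω j :=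
  monotone_nat_of_le_succ fun t => by
    classical
    rw [purchases_succ]; exact Nat.le_add_right _ _

/-- At a fixed time the purchase numbers range over a finite box, so every function of them is
bounded and no integrability condition on scores is needed. -/
theorem exists_abs_comp_purchases_le (g : (I → ℕ) → ℝ) (t : ℕ) :
    ∃ C, ∀ ω, |g (purchases d₀ X t ω)| ≤ C := by
  classical
  obtain ⟨C, hC⟩ := ((Set.finite_Iic fun j => d₀ j + t).image fun d => |g d|).bddAbove
  exact ⟨C, fun ω => hC ⟨_, fun j => purchases_le d₀ X t ω j, rfl⟩⟩

/-- The effect of a round on a function of the numbers of purchases. -/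
theorem comp_purchases_succ_sub [DecidableEq I] (g : (I → ℕ) → ℝ) (t : ℕ)
    (ω : Ω) : g (purchases d₀ X (t + 1) ω) - g (purchases d₀ X t ω)
      = ∑ p : U × I, (g (Function.update (purchases d₀ X t ω) p.2 (purchases d₀ X t ω p.2 + 1))
          - g (purchases d₀ X t ω))
        * {ω | X (t + 1) ω = (p.1, some (p.2, true))}.indicator (fun _ => (1 : ℝ)) ω := by
  classical
  by_cases h : ∃ i k, X (t + 1) ω = (i, some (k, true))
  · obtain ⟨i, k, h⟩ := h
    rw [Finset.sum_eq_single (i, k)]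
    · have e : purchases d₀ X (t + 1) ω
          = Function.update (purchases d₀ X t ω) k (purchases d₀ X t ω k + 1) := by
        ext j
        rw [purchases_succ, h]
        rcases eq_or_ne j k with rfl | hj
        · simp
        · simp [hj, hj.symm]
      simp [e, h]
    · rintro ⟨i', k'⟩ - hne
      rw [Set.indicator_of_notMem, mul_zero]
      intro h'
      rw [Set.mem_ofPred_eq, h] at h'
      simp only [Prod.mk.injEq, Option.some.injEq, and_true] at h'
      exact hne (by rw [h'.1, h'.2])
    · intro h'; exact absurd (Finset.mem_univ _) h'
  · push Not at h
    have e : purchases d₀ X (t + 1) ω = purchases d₀ X t ω := by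
      ext j
      rw [purchases_succ, if_neg]
      · rfl
      · rintro ⟨i, hi⟩; exact h i j hi
    rw [e, sub_self, Finset.sum_eq_zero]
    rintro ⟨i, k⟩ -
    rw [Set.indicator_of_notMem (by exact h i k), mul_zero]

end Purchases

variable {U I : Type*} [Fintype U] [Fintype I] {M : TrialOfferMarket U I} {d₀ : I → ℕ}
  {Ω : Type*} [m₀ : MeasurableSpace Ω] {μ : Measure Ω} {ℱ : Filtration ℕ m₀}
  {X : ℕ → Ω → TrialOfferOutcome U I}

namespace IsDynamic

theorem measurable_purchases (hX : M.IsDynamic d₀ μ ℱ X) (t : ℕ) :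
    Measurable[ℱ t] fun ω => purchases d₀ X t ω := by
  classical
  induction t with
  | zero => simp_rw [purchases_zero]; exact measurable_const
  | succ t ih =>
    have ih' := ih.mono (ℱ.mono (Nat.le_succ t)) le_rfl
    refine @measurable_pi_lambda _ _ _ (ℱ (t + 1)) _ _ fun j => ?_
    simp_rw [purchases_succ]
    refine Measurable.add ((measurable_pi_apply j).comp ih') (Measurable.ite ?_ measurable_const
      measurable_const)
    have : {ω | ∃ i, X (t + 1) ω = (i, some (j, true))}
        = ⋃ i, {ω | X (t + 1) ω = (i, some (j, true))} := by
      ext; simp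
    rw [this]
    exact MeasurableSet.iUnion fun i => hX.adapted (t + 1) (Nat.succ_pos t) _

theorem stronglyMeasurable_comp (hX : M.IsDynamic d₀ μ ℱ X) (g : (I → ℕ) → ℝ) (t : ℕ) :
    StronglyMeasurable[ℱ t] fun ω => g (purchases d₀ X t ω) :=
  ((measurable_of_countable g).comp (hX.measurable_purchases t)).stronglyMeasurable

theorem integrable_comp [IsFiniteMeasure μ] (hX : M.IsDynamic d₀ μ ℱ X) (g : (I → ℕ) → ℝ)
    (t : ℕ) : Integrable (fun ω => g (purchases d₀ X t ω)) μ := by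
  obtain ⟨C, hC⟩ := exists_abs_comp_purchases_le d₀ X g t
  exact Integrable.of_bound ((hX.stronglyMeasurable_comp g t).mono (ℱ.le t)).aestronglyMeasurable C
    (ae_of_all _ hC)

/-- The conditional drift of a function of the numbers of purchases. -/
theorem condExp_sub_eq [IsFiniteMeasure μ] [DecidableEq I] (hX : M.IsDynamic d₀ μ ℱ X)
    (g : (I → ℕ) → ℝ) (t : ℕ) :
    μ[fun ω => g (purchases d₀ X (t + 1) ω) - g (purchases d₀ X t ω) | ℱ t] =ᵐ[μ]
      fun ω => ∑ k, M.buyProb (share (purchases d₀ X t ω)) k *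
        (g (Function.update (purchases d₀ X t ω) k (purchases d₀ X t ω k + 1))
          - g (purchases d₀ X t ω)) := by
  let G : I → (I → ℕ) → ℝ := fun k d => g (Function.update d k (d k + 1)) - g d
  let A : U × I → Ω → ℝ := fun p => {ω | X (t + 1) ω = (p.1, some (p.2, true))}.indicator fun _ => 1
  have hA : ∀ p, Integrable (A p) μ := fun p => (integrable_const (1 : ℝ)).indicator
    (ℱ.le (t + 1) _ (hX.adapted (t + 1) (Nat.succ_pos t) _))
  have hGA : ∀ p : U × I, Integrable ((fun ω => G p.2 (purchases d₀ X t ω)) * A p) μ := by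
    intro p
    obtain ⟨C, hC⟩ := exists_abs_comp_purchases_le d₀ X (G p.2) t
    exact (hA p).bdd_mul (c := C)
      ((hX.stronglyMeasurable_comp (G p.2) t).mono (ℱ.le t)).aestronglyMeasurable (ae_of_all _ hC)
  -- The increment splits over the type and the item of the possible purchase; each coefficient is
  -- known at time t and leaves the conditional expectation.
  have e : (fun ω => g (purchases d₀ X (t + 1) ω) - g (purchases d₀ X t ω))
      = ∑ p : U × I, (fun ω => G p.2 (purchases d₀ X t ω)) * A p := by
    ext ω
    rw [comp_purchases_succ_sub, Finset.sum_apply]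
    rfl
  rw [e]
  refine (condExp_finsetSum (fun p _ => hGA p) _).trans ?_
  have h1 : ∀ p : U × I, μ[(fun ω => G p.2 (purchases d₀ X t ω)) * A p | ℱ t] =ᵐ[μ]
      fun ω => G p.2 (purchases d₀ X t ω) *
        M.roundProb (share (purchases d₀ X t ω)) (p.1, some (p.2, true)) := by
    intro p
    refine (condExp_mul_of_stronglyMeasurable_left (hX.stronglyMeasurable_comp (G p.2) t)
      (hGA p) (hA p)).trans ?_
    filter_upwards [hX.law t (p.1, some (p.2, true))] with ω hω
    simp only [Pi.mul_apply]
    rw [← hω]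
  filter_upwards [ae_all_iff.2 h1] with ω hω
  simp only [Finset.sum_apply, hω, Fintype.sum_prod_type]
  rw [Finset.sum_comm]
  refine Finset.sum_congr rfl fun k _ => ?_
  rw [← Finset.mul_sum, mul_comm]
  congr 1
  refine Finset.sum_congr rfl fun i _ => ?_
  simp only [roundProb, spending]
  ring

/-- A bounded-above function of the numbers of purchases whose drift dominates `a ≥ 0` still
converges after the sum of `a` along the path is subtracted. -/
theorem ae_exists_tendsto_sub_sum [IsFiniteMeasure μ] [DecidableEq I]
    (hX : M.IsDynamic d₀ μ ℱ X) {f a : (I → ℕ) → ℝ} {C : ℝ}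
    (hf : ∀ d, d₀ ≤ d → f d ≤ C) (ha : ∀ d, d₀ ≤ d → 0 ≤ a d)
    (hdrift : ∀ d, d₀ ≤ d →
      a d ≤ ∑ k, M.buyProb (share d) k * (f (Function.update d k (d k + 1)) - f d)) :
    ∀ᵐ ω ∂μ, ∃ c, Tendsto (fun t => f (purchases d₀ X t ω)
      - ∑ s ∈ Finset.range t, a (purchases d₀ X s ω)) atTop (𝓝 c) := by
  set Y : ℕ → Ω → ℝ := fun t ω => f (purchases d₀ X t ω)
      - ∑ s ∈ Finset.range t, a (purchases d₀ X s ω) with hY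
  have hadp : StronglyAdapted ℱ Y := fun t =>
    (hX.stronglyMeasurable_comp f t).sub (Finset.stronglyMeasurable_fun_sum _ fun s hs =>
      (hX.stronglyMeasurable_comp a s).mono (ℱ.mono (Finset.mem_range.1 hs).le))
  have hint : ∀ t, Integrable (Y t) μ := fun t => (hX.integrable_comp f t).sub
    (integrable_finsetSum _ fun s _ => hX.integrable_comp a s)
  have hsub : Submartingale Y ℱ μ := by
    refine submartingale_of_condExp_sub_nonneg_nat hadp hint fun t => ?_
    have e : Y (t + 1) - Y t = (fun ω => f (purchases d₀ X (t + 1) ω) - f (purchases d₀ X t ω))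
        - fun ω => a (purchases d₀ X t ω) := by
      ext ω
      simp only [hY, Pi.sub_apply, Finset.sum_range_succ]
      ring
    rw [e]
    have h1 := condExp_sub ((hX.integrable_comp f (t + 1)).sub (hX.integrable_comp f t))
      (hX.integrable_comp a t) (ℱ t)
    rw [condExp_of_stronglyMeasurable (ℱ.le t) (hX.stronglyMeasurable_comp a t)
      (hX.integrable_comp a t)] at h1
    filter_upwards [h1, hX.condExp_sub_eq f t] with ω hω1 hω2
    refine le_of_le_of_eq ?_ hω1.symm
    rw [Pi.sub_apply]
    refine sub_nonneg.2 (le_of_le_of_eq ?_ hω2.symm)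
    exact hdrift _ fun j => le_purchases d₀ X t ω j
  have hYC : ∀ t ω, Y t ω ≤ |C| := fun t ω => by
    have h1 := hf _ fun j => le_purchases d₀ X t ω j
    have h2 : 0 ≤ ∑ s ∈ Finset.range t, a (purchases d₀ X s ω) :=
      Finset.sum_nonneg fun s _ => ha _ fun j => le_purchases d₀ X s ω j
    have := le_abs_self C
    simp only [hY]
    linarith
  have hbdd : ∀ t, eLpNorm (Y t) 1 μ
      ≤ ((∫ _, 2 * |C| ∂μ - ∫ ω, Y 0 ω ∂μ).toNNReal : NNReal) := by
    intro t
    rw [eLpNorm_one_eq_lintegral_enorm, ← ofReal_integral_norm_eq_lintegral_enorm (hint t)]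
    refine ENNReal.ofReal_le_ofReal ?_
    have h1 : ∫ ω, Y 0 ω ∂μ ≤ ∫ ω, Y t ω ∂μ := by
      simpa using hsub.setIntegral_le (Nat.zero_le t) MeasurableSet.univ
    -- From Y ≤ |C| follows |Y| ≤ 2|C| - Y, and the mean of Y never drops below its initial value:
    -- this is the L¹ bound for Doob's theorem.
    have h2 : ∫ ω, ‖Y t ω‖ ∂μ ≤ ∫ ω, (2 * |C| - Y t ω) ∂μ := by
      refine integral_mono (hint t).norm ((integrable_const _).sub (hint t)) fun ω => ?_
      have := hYC t ω
      have := abs_nonneg C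
      simp only [Real.norm_eq_abs]
      rcases abs_cases (Y t ω) with h | h <;> linarith
    rw [integral_sub (integrable_const _) (hint t)] at h2
    linarith
  exact hsub.exists_ae_tendsto_of_bdd hbdd

/-- A bounded-above function of the numbers of purchases with drift at least `a ≥ 0` converges
almost surely, and the sum of `a` along the path is finite. -/
theorem ae_exists_tendsto_and_summable [IsFiniteMeasure μ] [DecidableEq I]
    (hX : M.IsDynamic d₀ μ ℱ X) {f a : (I → ℕ) → ℝ} {C : ℝ}
    (hf : ∀ d, d₀ ≤ d → f d ≤ C) (ha : ∀ d, d₀ ≤ d → 0 ≤ a d)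
    (hdrift : ∀ d, d₀ ≤ d →
      a d ≤ ∑ k, M.buyProb (share d) k * (f (Function.update d k (d k + 1)) - f d)) :
    ∀ᵐ ω ∂μ, (∃ c, Tendsto (fun t => f (purchases d₀ X t ω)) atTop (𝓝 c)) ∧
      Summable fun t => a (purchases d₀ X t ω) := by
  -- Used with `a` and again with 0: the difference of the two convergent sequences is the partial
  -- sum of `a`.
  filter_upwards [hX.ae_exists_tendsto_sub_sum hf ha hdrift,
    hX.ae_exists_tendsto_sub_sum (a := fun _ => 0) hf (fun _ _ => le_rfl)
      fun d hd => (ha d hd).trans (hdrift d hd)] with ω ⟨c, hc⟩ ⟨c', hc'⟩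
  simp only [Finset.sum_const_zero, sub_zero] at hc'
  refine ⟨⟨c', hc'⟩, ?_⟩
  have h1 := hc'.sub hc
  simp only [sub_sub_cancel] at h1
  have hs := (hasSum_iff_tendsto_nat_of_nonneg
    (fun t => ha _ fun j => le_purchases d₀ X t ω j) _).2 h1
  exact hs.summable

end IsDynamic

end TrialOfferMarket

/-! ### Scores of the purchase numbers and their drifts -/

/-- If `u t / N t` is summable with `N` of at most linear growth, then the limit of `u` is `0`. -/
theorem eq_zero_of_tendsto_of_summable_div {u N : ℕ → ℝ} {L A : ℝ} (hu : ∀ t, 0 ≤ u t)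
    (hN : ∀ t, 0 < N t) (hNA : ∀ t, N t ≤ A * (t + 1)) (hL : Tendsto u atTop (𝓝 L))
    (hs : Summable fun t => u t / N t) : L = 0 := by
  by_contra hne
  have hLpos : 0 < L := (ge_of_tendsto' hL hu).lt_of_ne (Ne.symm hne)
  have hA : 0 < A := by simpa using (hN 0).trans_le (hNA 0)
  have hev : ∀ᶠ t in atTop, L / 2 < u t := hL.eventually_const_lt (by linarith)
  obtain ⟨T, hT⟩ := eventually_atTop.1 hev
  have h1 : Summable fun t : ℕ => L / 2 / A * (1 / ((t + T : ℕ) + 1 : ℝ)) := by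
    refine Summable.of_nonneg_of_le (fun t => by positivity) (fun t => ?_)
      ((summable_nat_add_iff T).2 hs)
    rw [div_mul_div_comm, mul_one]
    exact div_le_div₀ (hu _) (hT _ (Nat.le_add_left _ _)).le (hN _) (hNA _)
  have h2 := (summable_mul_left_iff (by positivity : L / 2 / A ≠ 0)).1 h1
  have h3 : Summable fun t : ℕ => 1 / ((t : ℝ) + 1) :=
    (summable_nat_add_iff (f := fun t : ℕ => 1 / ((t : ℝ) + 1)) T).1 h2
  have h4 : Summable fun t : ℕ => 1 / (t : ℝ) := by
    refine (summable_nat_add_iff (f := fun t : ℕ => 1 / (t : ℝ)) 1).1 ?_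
    simpa using h3
  exact Real.not_summable_one_div_natCast h4

/-- The logarithm grows by at least 1/(n+1), and the correction -1/n makes up exactly the missing
1/n - 1/(n+1). This is why `logScore` carries the terms -1/d_j. -/
theorem one_div_le_log_succ_sub {n : ℝ} (hn : 1 ≤ n) :
    1 / n ≤ (Real.log (n + 1) - 1 / (n + 1)) - (Real.log n - 1 / n) := by
  have h0 : 0 < n := by linarith
  have h1 := Real.one_sub_inv_le_log_of_pos (by positivity : 0 < (n + 1) / n)
  rw [Real.log_div (by positivity) h0.ne', inv_div] at h1
  have h2 : 1 - n / (n + 1) = 1 / (n + 1) := by field_simp; ring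
  linarith

namespace TrialOfferMarket

variable {U I : Type*} [Fintype U] [Fintype I]

/-- The total number of purchases, each weighted by the inverse quality. -/
noncomputable def weightedTotal (q : I → ℝ) (d : I → ℕ) : ℝ := ∑ j, (d j : ℝ) / q j

/-- The market shares, scaled so as to lie in the quality simplex. -/
noncomputable def scaledShare (q : I → ℝ) (d : I → ℕ) (j : I) : ℝ := (weightedTotal q d)⁻¹ * d j

/-- A Lyapunov function of the numbers of purchases that increases on average. -/
noncomputable def logScore (q z : I → ℝ) (d : I → ℕ) : ℝ :=
  ∑ j, z j / q j * (Real.log (d j) - 1 / d j) - Real.log (weightedTotal q d)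

/-- For `r = 1`, a corrected potential of the numbers of purchases that increases on average. -/
noncomputable def potentialScore (M : TrialOfferMarket U I) (q : I → ℝ) (d : I → ℕ) : ℝ :=
  M.potential 1 (fun j => (d j : ℝ)) - Real.log (weightedTotal q d) - ∑ j, 2 / (d j : ℝ)

theorem share_pos {d : I → ℕ} (hd : ∀ j, 0 < d j) (j : I) : 0 < share d j := by
  have h : ∀ j, (0 : ℝ) < d j := fun j => by exact_mod_cast hd j
  exact div_pos (h j) (Finset.sum_pos (fun k _ => h k) ⟨j, Finset.mem_univ j⟩)

theorem weightedTotal_update [DecidableEq I] (q : I → ℝ) (d : I → ℕ) (k : I) :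
    weightedTotal q (Function.update d k (d k + 1)) = weightedTotal q d + 1 / q k := by
  have : ∀ j, ((Function.update d k (d k + 1) j : ℕ) : ℝ) / q j
      = d j / q j + if j = k then 1 / q k else 0 := by
    intro j
    rcases eq_or_ne j k with rfl | hj
    · simp [add_div]
    · simp [hj]
  simp_rw [weightedTotal, this, Finset.sum_add_distrib]
  simp

theorem sum_update_sub [DecidableEq I] (g : I → ℝ → ℝ) (d : I → ℕ) (k : I) :
    ∑ j, g j (Function.update d k (d k + 1) j : ℕ) - ∑ j, g j (d j)
      = g k (d k + 1) - g k (d k) := by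
  rw [← Finset.sum_sub_distrib, Finset.sum_eq_single k]
  · simp
  · intro j _ hj; simp [hj]
  · intro h; exact absurd (Finset.mem_univ _) h

namespace IsHomogeneous

variable {M : TrialOfferMarket U I} {q : I → ℝ} {r : ℝ}

theorem weightedTotal_pos (h : M.IsHomogeneous q r) {d : I → ℕ} (hd : ∀ j, 0 < d j) :
    0 < weightedTotal q d := by
  obtain ⟨⟨j⟩, -⟩ := h.nonempty
  exact Finset.sum_pos (fun k _ => div_pos (by exact_mod_cast hd k) (h.q_pos k))
    ⟨j, Finset.mem_univ j⟩

theorem scaledShare_pos (h : M.IsHomogeneous q r) {d : I → ℕ} (hd : ∀ j, 0 < d j) (j : I) :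
    0 < scaledShare q d j :=
  mul_pos (inv_pos.2 (h.weightedTotal_pos hd)) (by exact_mod_cast hd j)

theorem scaledShare_mem (h : M.IsHomogeneous q r) {d : I → ℕ} (hd : ∀ j, 0 < d j) :
    scaledShare q d ∈ qualitySimplex q := by
  refine ⟨fun j => (h.scaledShare_pos hd j).le, ?_⟩
  simp_rw [scaledShare, mul_div_assoc, ← Finset.mul_sum]
  exact inv_mul_cancel₀ (h.weightedTotal_pos hd).ne'

theorem tryProb_share (h : M.IsHomogeneous q r) {d : I → ℕ} (hd : ∀ j, 0 < d j) :
    M.tryProb (share d) = M.tryProb (scaledShare q d) := by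
  have h0 : ∀ j, (0 : ℝ) ≤ d j := fun j => Nat.cast_nonneg _
  obtain ⟨⟨j⟩, -⟩ := h.nonempty
  have h1 : (0 : ℝ) < ∑ k, (d k : ℝ) :=
    Finset.sum_pos (fun k _ => by exact_mod_cast hd k) ⟨j, Finset.mem_univ j⟩
  have e1 : share d = fun j => (∑ k, (d k : ℝ))⁻¹ * d j := by
    ext j; rw [share, div_eq_inv_mul]
  have e2 : scaledShare q d = fun j => (weightedTotal q d)⁻¹ * (d j : ℝ) := rfl
  rw [e1, e2, h.tryProb_mul h0 (inv_pos.2 h1),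
    h.tryProb_mul h0 (inv_pos.2 (h.weightedTotal_pos hd))]

theorem buyProb_share (h : M.IsHomogeneous q r) {d : I → ℕ} (hd : ∀ j, 0 < d j) :
    M.buyProb (share d) = M.buyProb (scaledShare q d) := by
  ext j
  simp_rw [h.buyProb_eq, demand, h.tryProb_share hd]

theorem log_weightedTotal_update_le [DecidableEq I] (h : M.IsHomogeneous q r) {d : I → ℕ}
    (hd : ∀ j, 0 < d j) (k : I) :
    Real.log (weightedTotal q (Function.update d k (d k + 1)))
      ≤ Real.log (weightedTotal q d) + 1 / q k * (weightedTotal q d)⁻¹ := by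
  have hN := h.weightedTotal_pos hd
  have hq := h.q_pos k
  have h1 := Real.log_le_sub_one_of_pos
    (by positivity : 0 < (weightedTotal q d + 1 / q k) / weightedTotal q d)
  rw [Real.log_div (by positivity) hN.ne', add_div, div_self hN.ne'] at h1
  rw [weightedTotal_update, ← div_eq_mul_inv]
  linarith

/-- The drift of `logScore`. -/
theorem le_drift_logScore [DecidableEq I] (h : M.IsHomogeneous q r) {z : I → ℝ}
    (hz : ∀ j, 0 ≤ z j) {d : I → ℕ} (hd : ∀ j, 0 < d j) :
    (∑ j, z j / q j * (M.buyProb (scaledShare q d) j / scaledShare q d j) - 1) / weightedTotal q d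
      ≤ ∑ k, M.buyProb (share d) k *
        (logScore q z (Function.update d k (d k + 1)) - logScore q z d) := by
  have hN := h.weightedTotal_pos hd
  have hx := h.scaledShare_pos hd
  rw [h.buyProb_share hd]
  have hy := h.buyProb_mem_qualitySimplex (fun j => (hx j).le) (h.attraction_pos hx)
  set y := M.buyProb (scaledShare q d)
  have key : ∀ k, z k / q k * (y k / scaledShare q d k) / weightedTotal q d
      - y k / q k / weightedTotal q d
      ≤ y k * (logScore q z (Function.update d k (d k + 1)) - logScore q z d) := by
    intro k
    have hdk : (1 : ℝ) ≤ d k := by exact_mod_cast hd k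
    have h1 : z k / q k * (1 / d k) - 1 / q k * (weightedTotal q d)⁻¹
        ≤ logScore q z (Function.update d k (d k + 1)) - logScore q z d := by
      have e := sum_update_sub (fun j t => z j / q j * (Real.log t - 1 / t)) d k
      have h2 := h.log_weightedTotal_update_le hd k
      have h3 := mul_le_mul_of_nonneg_left (one_div_le_log_succ_sub hdk)
        (div_nonneg (hz k) (h.q_pos k).le)
      simp only [logScore]
      linarith
    refine le_trans (le_of_eq ?_) (mul_le_mul_of_nonneg_left h1 (hy.1 k))
    have := (h.q_pos k).ne'
    rw [scaledShare]
    field_simp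
  refine le_trans (le_of_eq ?_) (Finset.sum_le_sum fun k _ => key k)
  rw [Finset.sum_sub_distrib, ← Finset.sum_div, ← Finset.sum_div, hy.2, sub_div]

/-- For `r = 1`, `potentialScore` does not decrease on average. -/
theorem drift_potentialScore_nonneg [DecidableEq I] (h : M.IsHomogeneous q 1) {d : I → ℕ}
    (hd : ∀ j, 0 < d j) :
    0 ≤ ∑ k, M.buyProb (share d) k *
        (M.potentialScore q (Function.update d k (d k + 1)) - M.potentialScore q d) := by
  have hN := h.weightedTotal_pos hd
  have hx := h.scaledShare_pos hd
  have hdp : ∀ j, (0 : ℝ) < d j := fun j => by exact_mod_cast hd j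
  have hS := h.attraction_pos hdp
  have hs : M.tryProb (scaledShare q d) = M.tryProb (fun j => (d j : ℝ)) :=
    h.tryProb_mul (fun j => (hdp j).le) (inv_pos.2 hN)
  rw [h.buyProb_share hd]
  have hy := h.buyProb_mem_qualitySimplex (fun j => (hx j).le) (h.attraction_pos hx)
  set y := M.buyProb (scaledShare q d) with hydef
  have hyd : ∀ k, y k / q k = M.demand (fun j => (d j : ℝ)) k := fun k => by
    rw [hydef, h.buyProb_div, demand, demand, hs]
  -- Cauchy–Schwarz in tangent form: y²/(qd) ≥ 2y/(qN) - d/(qN²), the difference being a square.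
  -- Summed over k, the left side is 2/N - N/N² - 1/N = 0.
  have key : ∀ k, 2 * (y k / q k) * (weightedTotal q d)⁻¹
        - d k / q k * (weightedTotal q d)⁻¹ ^ 2 - y k / q k * (weightedTotal q d)⁻¹
      ≤ y k * (M.potentialScore q (Function.update d k (d k + 1)) - M.potentialScore q d) := by
    intro k
    have hq := h.q_pos k
    have hdk : (1 : ℝ) ≤ d k := by exact_mod_cast hd k
    have hatt : ∀ i, M.attraction 1 (fun j => ((Function.update d k (d k + 1) j : ℕ) : ℝ)) i
        = M.attraction 1 (fun j => (d j : ℝ)) i + M.v i k := by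
      intro i
      have := sum_update_sub (fun j t => M.v i j * t ^ (1 : ℝ)) d k
      simp only [Real.rpow_one] at this
      simp only [attraction, Real.rpow_one]
      linarith
    -- One more purchase multiplies the attraction of type i by 1 + u with 0 ≤ u ≤ 1/d_k, and log(1
    -- + u) ≥ u - u².
    have hpot : y k / q k / d k - 1 / (d k : ℝ) ^ 2
        ≤ M.potential 1 (fun j => ((Function.update d k (d k + 1) j : ℕ) : ℝ))
          - M.potential 1 (fun j => (d j : ℝ)) := by
      have e : y k / q k / d k - 1 / (d k : ℝ) ^ 2 = ∑ i, M.w i *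
          (M.tryProb (fun j => (d j : ℝ)) i k / d k - 1 / (d k : ℝ) ^ 2) := by
        rw [hyd]
        simp_rw [mul_sub, Finset.sum_sub_distrib, ← Finset.sum_mul, M.w_sum, one_mul, demand,
          Finset.sum_div, mul_div_assoc]
      rw [e, potential, potential, ← Finset.sum_sub_distrib]
      refine Finset.sum_le_sum fun i _ => ?_
      rw [← mul_sub]
      refine mul_le_mul_of_nonneg_left ?_ (M.w_pos i).le
      have hA := hS i
      have hv := M.v_nonneg i k
      rw [hatt, ← Real.log_div (by positivity) hA.ne']
      set u := M.tryProb (fun j => (d j : ℝ)) i k / d k with hu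
      have hu0 : 0 ≤ u := div_nonneg (h.tryProb_nonneg (fun j => (hdp j).le) i k) (hdp k).le
      have hu1 : u ≤ 1 / d k :=
        div_le_div_of_nonneg_right (h.tryProb_le_one (fun j => (hdp j).le) hA k) (hdp k).le
      have hue : (M.attraction 1 (fun j => (d j : ℝ)) i + M.v i k)
          / M.attraction 1 (fun j => (d j : ℝ)) i = 1 + u := by
        have := (hdp k).ne'
        rw [hu, h.tryProb_eq, Real.rpow_one, add_div, div_self hA.ne']
        field_simp
      rw [hue]
      have h1 := Real.one_sub_inv_le_log_of_pos (by linarith : 0 < 1 + u)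
      have h2 : u - u ^ 2 ≤ 1 - (1 + u)⁻¹ := by
        have : 1 - (1 + u)⁻¹ = u / (1 + u) := by field_simp; ring
        rw [this, le_div_iff₀ (by linarith)]
        nlinarith [pow_nonneg hu0 3]
      have h3 : u ^ 2 ≤ 1 / (d k : ℝ) ^ 2 := by
        rw [← one_div_pow]; exact pow_le_pow_left₀ hu0 hu1 2
      linarith
    -- The correction 2/d_j in the score absorbs this second-order error: 2/(d(d+1)) ≥ 1/d² for d ≥
    -- 1.
    have hcorr : 1 / (d k : ℝ) ^ 2 ≤ 2 / (d k : ℝ) - 2 / ((d k : ℝ) + 1) := by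
      have : 2 / (d k : ℝ) - 2 / ((d k : ℝ) + 1) = 2 / ((d k : ℝ) * (d k + 1)) := by
        have := (hdp k).ne'
        field_simp; ring
      rw [this, div_le_div_iff₀ (by positivity) (by positivity)]
      nlinarith
    have h1 : y k / q k / d k - 1 / q k * (weightedTotal q d)⁻¹
        ≤ M.potentialScore q (Function.update d k (d k + 1)) - M.potentialScore q d := by
      have e := sum_update_sub (fun j t => 2 / t) d k
      have h2 := h.log_weightedTotal_update_le hd k
      simp only [potentialScore]
      linarith
    refine le_trans ?_ (mul_le_mul_of_nonneg_left h1 (hy.1 k))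
    have h4 : y k * (y k / q k / d k - 1 / q k * (weightedTotal q d)⁻¹)
        - (2 * (y k / q k) * (weightedTotal q d)⁻¹
        - d k / q k * (weightedTotal q d)⁻¹ ^ 2 - y k / q k * (weightedTotal q d)⁻¹)
        = d k / q k * (y k / d k - (weightedTotal q d)⁻¹) ^ 2 := by
      have := (hdp k).ne'
      field_simp; ring
    have : 0 ≤ d k / q k * (y k / d k - (weightedTotal q d)⁻¹) ^ 2 := by positivity
    linarith
  refine le_trans (le_of_eq ?_) (Finset.sum_le_sum fun k _ => key k)
  rw [Finset.sum_sub_distrib, Finset.sum_sub_distrib, ← Finset.sum_mul, ← Finset.sum_mul,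
    ← Finset.sum_mul, ← Finset.mul_sum, hy.2]
  change _ = 2 * 1 * _ - weightedTotal q d * _ - _
  field_simp
  ring

theorem entropyGap_scaledShare (h : M.IsHomogeneous q r) {z : I → ℝ} (hz : z ∈ qualitySimplex q)
    {d : I → ℕ} (hd : ∀ j, 0 < d j) :
    entropyGap q z (scaledShare q d) = ∑ j, z j / q j * Real.log (z j)
      - (logScore q z d + ∑ j, z j / q j * (1 / d j)) := by
  have hN := h.weightedTotal_pos hd
  have e : ∀ j, z j / q j * Real.log (z j / scaledShare q d j) = z j / q j * Real.log (z j)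
      - z j / q j * Real.log (d j) + z j / q j * Real.log (weightedTotal q d) := by
    intro j
    rcases (hz.1 j).eq_or_lt with h0 | h0
    · simp [← h0]
    have hdj : (d j : ℝ) ≠ 0 := by exact_mod_cast (hd j).ne'
    rw [Real.log_div h0.ne' (h.scaledShare_pos hd j).ne', scaledShare,
      Real.log_mul (inv_ne_zero hN.ne') hdj, Real.log_inv]
    ring
  simp_rw [entropyGap, e, logScore, mul_sub, Finset.sum_add_distrib, Finset.sum_sub_distrib,
    ← Finset.sum_mul, hz.2]
  ring

theorem potential_scaledShare (h : M.IsHomogeneous q 1) {d : I → ℕ} (hd : ∀ j, 0 < d j) :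
    M.potential 1 (scaledShare q d) = M.potentialScore q d + ∑ j, 2 / (d j : ℝ) := by
  have hdp : ∀ j, (0 : ℝ) < d j := fun j => by exact_mod_cast hd j
  have := h.potential_mul (fun j => (hdp j).le) (h.attraction_pos hdp)
    (inv_pos.2 (h.weightedTotal_pos hd))
  have e : scaledShare q d = fun j => (weightedTotal q d)⁻¹ * (d j : ℝ) := rfl
  rw [e, this, Real.log_inv, potentialScore]
  ring

/-- `logScore` is bounded above. -/
theorem logScore_le (h : M.IsHomogeneous q r) {z : I → ℝ} (hz : z ∈ qualitySimplex q)
    {d : I → ℕ} (hd : ∀ j, 0 < d j) : logScore q z d ≤ ∑ j, z j / q j * Real.log (z j) := by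
  have h1 := h.entropyGap_scaledShare hz hd
  have h2 := entropyGap_nonneg h.q_pos hz (h.scaledShare_mem hd)
    fun j e => absurd e (h.scaledShare_pos hd j).ne'
  have h3 : 0 ≤ ∑ j, z j / q j * (1 / (d j : ℝ)) := Finset.sum_nonneg fun j _ =>
    mul_nonneg (div_nonneg (hz.1 j) (h.q_pos j).le) (by positivity)
  linarith

theorem exists_weightedTotal_purchases_le (h : M.IsHomogeneous q r) {V Ω : Type*} [Fintype V]
    (d₀ : I → ℕ) (X : ℕ → Ω → TrialOfferOutcome V I) (ω : Ω) :
    ∃ A, ∀ t : ℕ, weightedTotal q (purchases d₀ X t ω) ≤ A * (t + 1) := by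
  -- This constant works because d₀ + t ≤ (d₀ + 1)(t + 1).
  refine ⟨∑ j, ((d₀ j : ℝ) + 1) / q j, fun t => ?_⟩
  rw [weightedTotal, Finset.sum_mul]
  refine Finset.sum_le_sum fun j _ => ?_
  rw [div_mul_eq_mul_div]
  refine div_le_div_of_nonneg_right ?_ (h.q_pos j).le
  have h1 : (purchases d₀ X t ω j : ℝ) ≤ d₀ j + t := by exact_mod_cast purchases_le d₀ X t ω j
  nlinarith [mul_nonneg (Nat.cast_nonneg (α := ℝ) (d₀ j)) (Nat.cast_nonneg (α := ℝ) t)]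

/-- Purchase numbers never decrease, so the corrections 1/d_j converge whether or not item j is
bought infinitely often. Convergence of a score thus passes to the entropy or the potential. -/
theorem exists_tendsto_one_div_purchases {V Ω : Type*} [Fintype V]
    (d₀ : I → ℕ) (X : ℕ → Ω → TrialOfferOutcome V I) (hd₀ : ∀ j, 0 < d₀ j) (ω : Ω) (j : I) :
    ∃ c, Tendsto (fun t => 1 / (purchases d₀ X t ω j : ℝ)) atTop (𝓝 c) := by
  refine ⟨_, tendsto_atTop_ciInf (fun s t hst => ?_) ⟨0, ?_⟩⟩
  · have : 0 < purchases d₀ X s ω j := (hd₀ j).trans_le (le_purchases d₀ X s ω j)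
    exact one_div_le_one_div_of_le (by exact_mod_cast this)
      (by exact_mod_cast purchases_mono d₀ X ω j hst)
  · rintro _ ⟨t, rfl⟩
    positivity

end IsHomogeneous

end TrialOfferMarket

/-! ### Almost sure convergence -/

namespace TrialOfferMarket

variable {U I : Type*} [Fintype U] [Fintype I]

namespace IsHomogeneous

variable {M : TrialOfferMarket U I} {q : I → ℝ} {r : ℝ}
  {V : Type*} [Fintype V] {M' : TrialOfferMarket V I} {c : ℝ} {d₀ : I → ℕ}
  {Ω : Type*} [m₀ : MeasurableSpace Ω] {μ : Measure Ω} [IsFiniteMeasure μ]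
  {ℱ : Filtration ℕ m₀} {X : ℕ → Ω → TrialOfferOutcome V I}

/-- Here M' is the market that is played and M its homogeneous reduction. The drift of `logScore` is
at least c G / N, so G / N is summable along the path; as N grows at most linearly, G has no other
possible limit than 0. -/
theorem ae_logScore (h : M.IsHomogeneous q r) (hc : 0 < c)
    (hbuy : ∀ φ : I → ℝ, (∀ j, 0 < φ j) → ∀ j, M'.buyProb φ j = c * M.buyProb φ j)
    (hX : M'.IsDynamic d₀ μ ℱ X) (hd₀ : ∀ j, 0 < d₀ j) {z : I → ℝ} (hz : z ∈ qualitySimplex q)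
    {G : (I → ℝ) → ℝ} (hG : ∀ x ∈ qualitySimplex q, (∀ j, 0 < x j) → 0 ≤ G x ∧
      1 + G x ≤ ∑ j, z j / q j * (M.buyProb x j / x j)) :
    ∀ᵐ ω ∂μ, (∃ l, Tendsto (fun t => logScore q z (purchases d₀ X t ω)) atTop (𝓝 l)) ∧
      ∀ L, Tendsto (fun t => G (scaledShare q (purchases d₀ X t ω))) atTop (𝓝 L) → L = 0 := by
  classical
  have hpos : ∀ d, d₀ ≤ d → ∀ j, 0 < d j := fun d hd j => (hd₀ j).trans_le (hd j)
  have hG' : ∀ d, d₀ ≤ d → 0 ≤ G (scaledShare q d) ∧ 1 + G (scaledShare q d)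
      ≤ ∑ j, z j / q j * (M.buyProb (scaledShare q d) j / scaledShare q d j) := fun d hd =>
    hG _ (h.scaledShare_mem (hpos d hd)) (h.scaledShare_pos (hpos d hd))
  filter_upwards [hX.ae_exists_tendsto_and_summable (f := logScore q z)
    (a := fun d => c * (G (scaledShare q d) / weightedTotal q d))
    (fun d hd => h.logScore_le hz (hpos d hd))
    (fun d hd => mul_nonneg hc.le
      (div_nonneg (hG' d hd).1 (h.weightedTotal_pos (hpos d hd)).le))
    (fun d hd => by
      simp_rw [hbuy _ (share_pos (hpos d hd)), mul_assoc, ← Finset.mul_sum]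
      refine mul_le_mul_of_nonneg_left ?_ hc.le
      refine le_trans ?_ (h.le_drift_logScore hz.1 (hpos d hd))
      exact div_le_div_of_nonneg_right (by linarith [(hG' d hd).2])
        (h.weightedTotal_pos (hpos d hd)).le)] with ω ⟨h1, h2⟩
  refine ⟨h1, fun L hL => ?_⟩
  have hle : ∀ t, d₀ ≤ purchases d₀ X t ω := fun t j => le_purchases d₀ X t ω j
  obtain ⟨A, hA⟩ := h.exists_weightedTotal_purchases_le d₀ X ω
  exact eq_zero_of_tendsto_of_summable_div (fun t => (hG' _ (hle t)).1)
    (fun t => h.weightedTotal_pos (hpos _ (hle t))) hA hL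
    ((summable_mul_left_iff hc.ne').1 h2)

/-- For `r < 1` the scaled market shares converge almost surely to the fixed point. -/
theorem ae_tendsto_fixedPoint (h : M.IsHomogeneous q r) (hr1 : r < 1) (hc : 0 < c)
    (hbuy : ∀ φ : I → ℝ, (∀ j, 0 < φ j) → ∀ j, M'.buyProb φ j = c * M.buyProb φ j)
    (hX : M'.IsDynamic d₀ μ ℱ X) (hd₀ : ∀ j, 0 < d₀ j) {z : I → ℝ} (hz : z ∈ qualitySimplex q)
    (hzp : ∀ j, 0 < z j) (hfix : M.buyProb z = z)
    (hmax : ∀ x ∈ qualitySimplex q, (∀ i, 0 < M.attraction r x i) →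
        M.potential r x ≤ M.potential r z) :
    ∀ᵐ ω ∂μ, Tendsto (fun t => scaledShare q (purchases d₀ X t ω)) atTop (𝓝 z) := by
  have hpos : ∀ t ω j, 0 < purchases d₀ X t ω j := fun t ω j =>
    (hd₀ j).trans_le (le_purchases d₀ X t ω j)
  -- Since z maximises the potential, the term Φ(z) - Φ(x) of the drift inequality can be dropped,
  -- leaving the entropy as the gain.
  filter_upwards [h.ae_logScore hc hbuy hX hd₀ hz (G := fun x => (1 - r) * entropyGap q z x)
    fun x hx hxp => ⟨mul_nonneg (sub_nonneg.2 hr1.le)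
      (entropyGap_nonneg h.q_pos hz hx fun j e => absurd e (hxp j).ne'), by
        linarith [h.drift_of_fixedPoint hzp hfix hxp, hmax x hx (h.attraction_pos hxp)]⟩]
    with ω ⟨⟨l, hl⟩, hlim⟩
  choose e he using fun j => exists_tendsto_one_div_purchases d₀ X hd₀ ω j
  have h1 : Tendsto (fun t => entropyGap q z (scaledShare q (purchases d₀ X t ω))) atTop
      (𝓝 (∑ j, z j / q j * Real.log (z j) - (l + ∑ j, z j / q j * e j))) := by
    simp_rw [h.entropyGap_scaledShare hz (hpos _ ω)]
    exact tendsto_const_nhds.sub (hl.add (tendsto_finsetSum _ fun j _ => (he j).const_mul _))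
  have h2 := hlim _ (h1.const_mul (1 - r))
  rw [mul_eq_zero, or_iff_right (sub_pos.2 hr1).ne'] at h2
  rw [h2] at h1
  exact tendsto_of_entropyGap_tendsto_zero h.q_pos hz (fun t => h.scaledShare_mem (hpos t ω))
    (fun t => h.scaledShare_pos (hpos t ω)) h1

theorem tendsto_potential (h : M.IsHomogeneous q r) {z : I → ℝ} (hzp : ∀ j, 0 < z j)
    {x : ℕ → I → ℝ} (hx : Tendsto x atTop (𝓝 z)) :
    Tendsto (fun t => M.potential r (x t)) atTop (𝓝 (M.potential r z)) := by
  refine tendsto_finsetSum _ fun i _ => Tendsto.const_mul _ ?_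
  refine Tendsto.log ?_ (h.attraction_pos hzp i).ne'
  exact tendsto_finsetSum _ fun k _ =>
    ((tendsto_pi_nhds.1 hx k).rpow_const (Or.inl (hzp k).ne')).const_mul _

/-- For `r = 1` the potential converges almost surely to its maximum. -/
theorem ae_tendsto_potential_of_r_eq_one (h : M.IsHomogeneous q 1) (hc : 0 < c)
    (hbuy : ∀ φ : I → ℝ, (∀ j, 0 < φ j) → ∀ j, M'.buyProb φ j = c * M.buyProb φ j)
    (hX : M'.IsDynamic d₀ μ ℱ X) (hd₀ : ∀ j, 0 < d₀ j) {z : I → ℝ} (hz : z ∈ qualitySimplex q)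
    (hS : ∀ i, 0 < M.attraction 1 z i)
    (hmax : ∀ x ∈ qualitySimplex q, (∀ i, 0 < M.attraction 1 x i) →
        M.potential 1 x ≤ M.potential 1 z) :
    ∀ᵐ ω ∂μ, Tendsto (fun t => M.potential 1 (scaledShare q (purchases d₀ X t ω))) atTop
      (𝓝 (M.potential 1 z)) := by
  classical
  have hpos' : ∀ d, d₀ ≤ d → ∀ j, 0 < d j := fun d hd j => (hd₀ j).trans_le (hd j)
  have hpos : ∀ t ω j, 0 < purchases d₀ X t ω j := fun t ω =>
    hpos' _ fun j => le_purchases d₀ X t ω j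
  -- The first submartingale shows that the gap Φ(z) - Φ(x^t) can only tend to 0, the second that it
  -- tends to something.
  filter_upwards [h.ae_logScore hc hbuy hX hd₀ hz
    (G := fun x => M.potential 1 z - M.potential 1 x)
    (fun x hx hxp => ⟨sub_nonneg.2 (hmax x hx (h.attraction_pos hxp)), h.drift_of_r_eq_one hS hxp⟩),
    hX.ae_exists_tendsto_and_summable (f := M.potentialScore q) (a := fun _ => 0)
      (C := M.potential 1 z)
      (fun d hd => by
        have h1 := hmax _ (h.scaledShare_mem (hpos' d hd))
          (h.attraction_pos (h.scaledShare_pos (hpos' d hd)))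
        rw [h.potential_scaledShare (hpos' d hd)] at h1
        have h2 : 0 ≤ ∑ j, 2 / (d j : ℝ) := Finset.sum_nonneg fun j _ => by positivity
        linarith)
      (fun _ _ => le_rfl)
      (fun d hd => by
        simp_rw [hbuy _ (share_pos (hpos' d hd)), mul_assoc, ← Finset.mul_sum]
        exact mul_nonneg hc.le (h.drift_potentialScore_nonneg (hpos' d hd)))]
    with ω ⟨_, hlim⟩ ⟨⟨l, hl⟩, _⟩
  choose e he using fun j => exists_tendsto_one_div_purchases d₀ X hd₀ ω j
  have h1 : Tendsto (fun t => M.potential 1 (scaledShare q (purchases d₀ X t ω))) atTop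
      (𝓝 (l + ∑ j, 2 * e j)) := by
    simp_rw [h.potential_scaledShare (hpos _ ω)]
    refine hl.add (tendsto_finsetSum _ fun j _ => ((he j).const_mul 2).congr fun t => ?_)
    ring
  have h2 := hlim _ (h1.const_sub _)
  rwa [← sub_eq_zero.1 h2] at h1

/-- For `r ≤ 1` the potential has a maximiser and converges almost surely to its maximum. -/
theorem exists_ae_tendsto_potential (h : M.IsHomogeneous q r) (hr1 : r ≤ 1) (hc : 0 < c)
    (hbuy : ∀ φ : I → ℝ, (∀ j, 0 < φ j) → ∀ j, M'.buyProb φ j = c * M.buyProb φ j)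
    (hX : M'.IsDynamic d₀ μ ℱ X) (hd₀ : ∀ j, 0 < d₀ j) :
    ∃ z ∈ qualitySimplex q, (∀ i, 0 < M.attraction r z i) ∧
      (∀ i j, z j = 0 → M.tryProb z i j = 0) ∧
      (∀ x ∈ qualitySimplex q, (∀ i, 0 < M.attraction r x i) →
        M.potential r x ≤ M.potential r z) ∧
      ∀ᵐ ω ∂μ, Tendsto (fun t => M.potential r (scaledShare q (purchases d₀ X t ω))) atTop
        (𝓝 (M.potential r z)) := by
  rcases hr1.eq_or_lt with rfl | hr
  · obtain ⟨z, hz, hS, hmax⟩ := h.exists_isMax_potential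
    exact ⟨z, hz, hS, h.tryProb_eq_zero one_pos z, hmax,
      h.ae_tendsto_potential_of_r_eq_one hc hbuy hX hd₀ hz hS hmax⟩
  · obtain ⟨z, hz, hzp, hfix, hmax⟩ := h.exists_fixedPoint hr
    refine ⟨z, hz, h.attraction_pos hzp, fun i j e => absurd e (hzp j).ne', hmax, ?_⟩
    filter_upwards [h.ae_tendsto_fixedPoint hr hc hbuy hX hd₀ hz hzp hfix hmax] with ω hω
    exact h.tendsto_potential hzp hω

/-- Convergence of the objective to its maximum. -/
theorem exists_ae_tendsto_Gamma (h : M.IsHomogeneous q r) (hr1 : r ≤ 1) (hc : 0 < c)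
    (hbuy : ∀ φ : I → ℝ, (∀ j, 0 < φ j) → ∀ j, M'.buyProb φ j = c * M.buyProb φ j)
    (hX : M'.IsDynamic d₀ μ ℱ X) (hd₀ : ∀ j, 0 < d₀ j) :
    ∃ Γstar : ℝ, IsGreatest (Gamma r M.v q '' feasible M.w q) (Γstar : EReal) ∧
      ∀ᵐ ω ∂μ, Tendsto (fun t => Gamma r M.v q (M.spending (share (purchases d₀ X t ω))))
        atTop (𝓝 (Γstar : EReal)) := by
  obtain ⟨z, hz, hS, hz0, hmax, hlim⟩ := h.exists_ae_tendsto_potential hr1 hc hbuy hX hd₀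
  have hle : ∀ b ∈ feasible M.w q, (∀ i j, M.v i j = 0 → b i j = 0) →
      gammaVal r M.v q b ≤ M.potential r z - ∑ i, M.w i * Real.log (M.w i) := fun b hb hb0 =>
    (h.gammaVal_le hb hb0).trans (sub_le_sub_right
      (hmax _ (sum_mem_qualitySimplex hb) (h.attraction_sum_pos hb hb0)) _)
  have hsz := h.spending_mem_feasible hz.1 hS
  refine ⟨M.potential r z - ∑ i, M.w i * Real.log (M.w i), ⟨⟨_, hsz, ?_⟩, ?_⟩, ?_⟩
  · rw [Gamma_eq_gammaVal (h.spending_eq_zero z)]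
    exact congrArg _ (le_antisymm (hle _ hsz (h.spending_eq_zero z))
      (h.le_gammaVal_spending hz hS hz0))
  · rintro _ ⟨b, hb, rfl⟩
    by_cases hb0 : ∀ i j, M.v i j = 0 → b i j = 0
    · rw [Gamma_eq_gammaVal hb0]
      exact EReal.coe_le_coe_iff.2 (hle b hb hb0)
    · rw [Gamma_eq_bot hb0]
      exact bot_le
  · filter_upwards [hlim] with ω hω
    have hpos : ∀ t j, 0 < purchases d₀ X t ω j := fun t j =>
      (hd₀ j).trans_le (le_purchases d₀ X t ω j)
    have e : ∀ t, M.spending (share (purchases d₀ X t ω))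
        = M.spending (scaledShare q (purchases d₀ X t ω)) := by
      intro t; ext i j
      rw [spending, spending, h.tryProb_share (hpos t)]
    simp_rw [e, Gamma_eq_gammaVal (h.spending_eq_zero _)]
    -- The objective is squeezed between Φ(x^t) - const, as entropies are nonnegative, and its
    -- maximum Φ(z) - const.
    refine (continuous_coe_real_ereal.tendsto _).comp
      (tendsto_of_tendsto_of_tendsto_of_le_of_le (hω.sub_const _) tendsto_const_nhds
        (fun t => ?_) fun t => ?_)
    · exact h.le_gammaVal_spending (h.scaledShare_mem (hpos t))
        (h.attraction_pos (h.scaledShare_pos (hpos t)))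
        fun i j e => absurd e (h.scaledShare_pos (hpos t) j).ne'
    · exact hle _ (h.spending_mem_feasible (fun j => (h.scaledShare_pos (hpos t) j).le)
        (h.attraction_pos (h.scaledShare_pos (hpos t)))) (h.spending_eq_zero _)

/-- Interior equilibria are the fixed points, up to scaling. -/
theorem buyProb_smul_of_isInteriorTOME (h : M.IsHomogeneous q r) (hc : 0 < c)
    (hbuy : ∀ φ : I → ℝ, (∀ j, 0 < φ j) → ∀ j, M'.buyProb φ j = c * M.buyProb φ j)
    {ψ : I → ℝ} (hψ : M'.IsInteriorTOME ψ) :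
    ∃ a > 0, (fun j => a * ψ j) ∈ qualitySimplex q ∧
      M.buyProb (fun j => a * ψ j) = fun j => a * ψ j := by
  obtain ⟨⟨-, hfix⟩, hpos⟩ := hψ
  have hb : ∀ j, 0 < M.buyProb ψ j := fun j => by
    rw [h.buyProb_eq]; exact mul_pos (h.q_pos j) (h.demand_pos hpos j)
  obtain ⟨⟨j₀⟩, -⟩ := h.nonempty
  have hY : 0 < ∑ k, M.buyProb ψ k :=
    Finset.sum_pos (fun k _ => hb k) ⟨j₀, Finset.mem_univ j₀⟩
  -- The scaling factor is the total purchase probability in M: by equilibrium, `buyProb` at ψ is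
  -- that multiple of ψ, and it lies in the simplex.
  have e : (fun j => (∑ k, M.buyProb ψ k) * ψ j) = M.buyProb ψ := by
    ext j
    have := congrFun hfix j
    simp_rw [nextProb, hbuy ψ hpos, ← Finset.mul_sum] at this
    rw [mul_div_mul_left _ _ hc.ne', div_eq_iff hY.ne'] at this
    rw [this, mul_comm]
  refine ⟨∑ k, M.buyProb ψ k, hY, ?_, ?_⟩
  · rw [e]
    exact h.buyProb_mem_qualitySimplex (fun j => (hpos j).le) (h.attraction_pos hpos)
  · rw [h.buyProb_mul (fun j => (hpos j).le) hY, e]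

/-- For `r < 1` there is a unique interior equilibrium, and the market shares converge to it. -/
theorem exists_unique_interiorTOME (h : M.IsHomogeneous q r) (hr1 : r < 1) (hc : 0 < c)
    (hbuy : ∀ φ : I → ℝ, (∀ j, 0 < φ j) → ∀ j, M'.buyProb φ j = c * M.buyProb φ j)
    (hX : M'.IsDynamic d₀ μ ℱ X) (hd₀ : ∀ j, 0 < d₀ j) :
    ∃ φstar : I → ℝ, M'.IsInteriorTOME φstar ∧ (∀ ψ, M'.IsInteriorTOME ψ → ψ = φstar) ∧
      ∀ᵐ ω ∂μ, Tendsto (fun t => share (purchases d₀ X t ω)) atTop (𝓝 φstar) := by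
  obtain ⟨z, hz, hzp, hfix, hmax⟩ := h.exists_fixedPoint hr1
  obtain ⟨⟨j₀⟩, -⟩ := h.nonempty
  have hsum : ∀ x : I → ℝ, (∀ j, 0 < x j) → 0 < ∑ k, x k := fun x hx =>
    Finset.sum_pos (fun k _ => hx k) ⟨j₀, Finset.mem_univ j₀⟩
  have hpos : ∀ j, 0 < z j / ∑ k, z k := fun j => div_pos (hzp j) (hsum z hzp)
  refine ⟨fun j => z j / ∑ k, z k, ⟨⟨⟨fun j => (hpos j).le, ?_⟩, ?_⟩, hpos⟩, ?_, ?_⟩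
  · rw [← Finset.sum_div]
    exact div_self (hsum z hzp).ne'
  · have e : M.buyProb (fun j => z j / ∑ k, z k) = z := by
      simp_rw [div_eq_inv_mul]
      rw [h.buyProb_mul (fun j => (hzp j).le) (inv_pos.2 (hsum z hzp)), hfix]
    ext j
    simp_rw [nextProb, hbuy _ hpos, ← Finset.mul_sum]
    rw [e, mul_div_mul_left _ _ hc.ne']
  · intro ψ hψ
    obtain ⟨a, ha, hmem, hfix'⟩ := h.buyProb_smul_of_isInteriorTOME hc hbuy hψ
    have e := h.fixedPoint_unique hr1 hz hmem hzp (fun j => mul_pos ha (hψ.2 j)) hfix hfix'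
    ext j
    rw [← e]
    simp_rw [← Finset.mul_sum]
    rw [hψ.1.1.2, mul_one, mul_div_cancel_left₀ _ ha.ne']
  · filter_upwards [h.ae_tendsto_fixedPoint hr1 hc hbuy hX hd₀ hz hzp hfix hmax] with ω hω
    have hω' := tendsto_pi_nhds.1 hω
    refine tendsto_pi_nhds.2 fun j => ?_
    refine ((hω' j).div (tendsto_finsetSum _ fun k _ => hω' k) (hsum z hzp).ne').congr fun t => ?_
    have hp : ∀ j, 0 < purchases d₀ X t ω j := fun j =>
      (hd₀ j).trans_le (le_purchases d₀ X t ω j)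
    simp only [scaledShare, Pi.div_apply]
    rw [← Finset.mul_sum, mul_div_mul_left _ _ (inv_pos.2 (h.weightedTotal_pos hp)).ne', share]

end IsHomogeneous

/-! ### Reduction to homogeneous markets and the main theorem -/

/-- The single-type market equivalent to one with common visibilities. -/
noncomputable def averaged (M : TrialOfferMarket U I) (r : ℝ) (hr : 0 ≤ r) (v : I → ℝ)
    (hv : ∀ j, 0 ≤ v j) : TrialOfferMarket Unit I where
  w _ := 1
  v _ := v
  q _ j := ∑ i, M.w i * M.q i j
  r _ := r
  w_pos _ := one_pos
  w_sum := by simp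
  v_nonneg _ := hv
  q_nonneg _ j := Finset.sum_nonneg fun i _ => mul_nonneg (M.w_pos i).le (M.q_nonneg i j)
  q_le_one _ j := M.w_sum ▸ Finset.sum_le_sum fun i _ =>
    mul_le_of_le_one_right (M.w_pos i).le (M.q_le_one i j)
  r_nonneg _ := hr

/-- With common visibilities and exponent the trial probabilities do not depend on the type, so
types enter the total spending only through the average quality. -/
theorem averaged_spending (M : TrialOfferMarket U I) {r : ℝ} (hr : 0 ≤ r)
    (hMr : ∀ i, M.r i = r) {v : I → ℝ} (hv : ∀ j, 0 ≤ v j) (hMv : ∀ i j, M.v i j = v j)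
    (φ : I → ℝ) (i : Unit) (j : I) :
    (M.averaged r hr v hv).spending φ i j = ∑ i, M.spending φ i j := by
  simp [averaged, spending, tryProb, hMr, hMv, Finset.sum_mul]

theorem averaged_isHomogeneous [Nonempty I] (M : TrialOfferMarket U I)
    (hM : ∀ j, ∃ i, 0 < M.v i j * M.q i j) {r : ℝ} (hr : 0 ≤ r)
    {v : I → ℝ} (hv : ∀ j, 0 ≤ v j) (hMv : ∀ i j, M.v i j = v j) :
    (M.averaged r hr v hv).IsHomogeneous (fun j => ∑ i, M.w i * M.q i j) r := by
  have hvp : ∀ j, 0 < v j := fun j => by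
    obtain ⟨i, hi⟩ := hM j
    rw [hMv] at hi
    exact pos_of_mul_pos_left hi (M.q_nonneg i j)
  refine ⟨fun _ => rfl, fun _ _ => rfl, fun j => ?_, fun _ => ?_, fun j => ⟨(), hvp j⟩⟩
  · obtain ⟨i, hi⟩ := hM j
    exact Finset.sum_pos' (fun i _ => mul_nonneg (M.w_pos i).le (M.q_nonneg i j))
      ⟨i, Finset.mem_univ i, mul_pos (M.w_pos i) (pos_of_mul_pos_right hi (M.v_nonneg i j))⟩
  · obtain ⟨j⟩ := ‹Nonempty I›
    exact ⟨j, hvp j⟩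

open Classical in
theorem sum_seeing_pos (M : TrialOfferMarket U I) (hs : ∃ i j, 0 < M.v i j) :
    0 < ∑ k : {i : U // ∃ j, 0 < M.v i j}, M.w k := by
  obtain ⟨i, hi⟩ := hs
  exact Finset.sum_pos (fun k _ => M.w_pos k) ⟨⟨i, hi⟩, Finset.mem_univ _⟩

open Classical in
/-- The market with the types that see no item removed. -/
noncomputable def restrictSeeing (M : TrialOfferMarket U I) (hs : ∃ i j, 0 < M.v i j) :
    TrialOfferMarket {i : U // ∃ j, 0 < M.v i j} I where
  w i := M.w i / ∑ k : {i : U // ∃ j, 0 < M.v i j}, M.w k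
  v i := M.v i
  q i := M.q i
  r i := M.r i
  w_pos i := div_pos (M.w_pos i) (M.sum_seeing_pos hs)
  w_sum := by
    rw [← Finset.sum_div]
    exact div_self (M.sum_seeing_pos hs).ne'
  v_nonneg i := M.v_nonneg i
  q_nonneg i := M.q_nonneg i
  q_le_one i := M.q_le_one i
  r_nonneg i := M.r_nonneg i

-- Types that see nothing never buy, so dropping them only renormalises the weights; c is the total
-- weight of the remaining types.
open Classical in
theorem restrictSeeing_buyProb (M : TrialOfferMarket U I) (hs : ∃ i j, 0 < M.v i j) :
    ∃ c > 0, ∀ φ j, M.buyProb φ j = c * (M.restrictSeeing hs).buyProb φ j := by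
  have hW : 0 < ∑ k : {i : U // ∃ j, 0 < M.v i j}, M.w k :=
    M.sum_seeing_pos hs
  refine ⟨_, hW, fun φ j => ?_⟩
  have e : ∀ i : {i : U // ∃ j, 0 < M.v i j},
      (∑ k : {i : U // ∃ j, 0 < M.v i j}, M.w k) * (M.restrictSeeing hs).spending φ i j
        = M.spending φ i j := by
    intro i
    have ht : (M.restrictSeeing hs).tryProb φ i j = M.tryProb φ i j := rfl
    have hw : (M.restrictSeeing hs).w i
      = M.w i / ∑ k : {i : U // ∃ j, 0 < M.v i j}, M.w k := rfl
    have hq : (M.restrictSeeing hs).q i j = M.q i j := rfl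
    rw [spending, spending, ht, hw, hq]
    field_simp
  rw [buyProb, buyProb, Finset.mul_sum]
  simp_rw [e]
  rw [← Finset.sum_subtype (Finset.univ.filter fun i => ∃ j, 0 < M.v i j) (by simp)
    fun i => M.spending φ i j]
  refine (Finset.sum_filter_of_ne fun i _ hne => ?_).symm
  by_contra! hv
  exact hne (by simp [spending, tryProb, le_antisymm (hv j) (M.v_nonneg i j)])

theorem restrictSeeing_isHomogeneous [Nonempty I] (M : TrialOfferMarket U I)
    (hM : ∀ j, ∃ i, 0 < M.v i j * M.q i j) {r : ℝ} (hMr : ∀ i, M.r i = r) {q : I → ℝ}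
    (hMq : ∀ i j, M.q i j = q j) (hs : ∃ i j, 0 < M.v i j) :
    (M.restrictSeeing hs).IsHomogeneous q r := by
  refine ⟨fun i => hMr i, fun i => hMq i, fun j => ?_, fun i => i.2, fun j => ?_⟩
  · obtain ⟨i, hi⟩ := hM j
    exact hMq i j ▸ pos_of_mul_pos_right hi (M.v_nonneg i j)
  · obtain ⟨i, hi⟩ := hM j
    have hv := pos_of_mul_pos_left hi (M.q_nonneg i j)
    exact ⟨⟨i, j, hv⟩, hv⟩

end TrialOfferMarket

theorem mainTheorem2 {U I : Type*} [Fintype U] [Fintype I] [Nonempty I]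
    (M : TrialOfferMarket U I)
    (hM : ∀ j, ∃ i, 0 < M.v i j * M.q i j)
    (r : ℝ) (hr : ∀ i, M.r i = r)
    (d₀ : I → ℕ) (hd₀ : ∀ j, 0 < TrialOfferMarket.share d₀ j)
    {Ω : Type*} [m₀ : MeasurableSpace Ω] (μ : Measure Ω) [IsProbabilityMeasure μ]
    (ℱ : Filtration ℕ m₀) (X : ℕ → Ω → TrialOfferOutcome U I)
    (hX : M.IsDynamic d₀ μ ℱ X)
    (hcase : (∃ v : I → ℝ, ∀ i j, M.v i j = v j) ∨ (∃ q : I → ℝ, ∀ i j, M.q i j = q j)) :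
    -- convergence of the market share to the unique interior equilibrium
    (r < 1 → ∃ φstar : I → ℝ, M.IsInteriorTOME φstar ∧
      (∀ ψ, M.IsInteriorTOME ψ → ψ = φstar) ∧
      ∀ᵐ ω ∂μ, Tendsto (fun t => TrialOfferMarket.share (TrialOfferMarket.purchases d₀ X t ω))
        atTop (𝓝 φstar)) ∧
    -- common qualities: the objective converges to its maximum
    (r ≤ 1 → ∀ q : I → ℝ, (∀ i j, M.q i j = q j) → (∀ i, ∃ j, 0 < M.v i j) →
      ∃ Γstar : ℝ,
        IsGreatest (TrialOfferMarket.Gamma r M.v q '' TrialOfferMarket.feasible M.w q)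
          (Γstar : EReal) ∧
        ∀ᵐ ω ∂μ, Tendsto (fun t => TrialOfferMarket.Gamma r M.v q
            (M.spending (TrialOfferMarket.share (TrialOfferMarket.purchases d₀ X t ω))))
          atTop (𝓝 (Γstar : EReal))) ∧
    -- common visibilities: the same for the equivalent market with a single type of users, whose
    -- qualities are the averages of the `M.q i j` and whose spendings are the total spendings
    (r ≤ 1 → ∀ v : I → ℝ, (∀ i j, M.v i j = v j) →
      ∃ Γstar : ℝ,
        IsGreatest (TrialOfferMarket.Gamma r (fun _ : Unit => v) (fun j => ∑ i, M.w i * M.q i j) ''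
          TrialOfferMarket.feasible (fun _ : Unit => 1) (fun j => ∑ i, M.w i * M.q i j))
          (Γstar : EReal) ∧
        ∀ᵐ ω ∂μ, Tendsto (fun t => TrialOfferMarket.Gamma r (fun _ : Unit => v)
            (fun j => ∑ i, M.w i * M.q i j)
            (fun _ j => ∑ i,
              M.spending (TrialOfferMarket.share (TrialOfferMarket.purchases d₀ X t ω)) i j))
          atTop (𝓝 (Γstar : EReal))) := by
  have hd₀' : ∀ j, 0 < d₀ j := fun j => Nat.pos_of_ne_zero fun e => by
    have := hd₀ j
    simp [TrialOfferMarket.share, e] at this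
  obtain ⟨j₀⟩ := ‹Nonempty I›
  have hs : ∃ i j, 0 < M.v i j := by
    obtain ⟨i, hi⟩ := hM j₀
    exact ⟨i, j₀, pos_of_mul_pos_left hi (M.q_nonneg i j₀)⟩
  have hr0 : 0 ≤ r := by
    obtain ⟨i, -⟩ := hs
    exact hr i ▸ M.r_nonneg i
  have hv0 : ∀ v : I → ℝ, (∀ i j, M.v i j = v j) → ∀ j, 0 ≤ v j := fun v hv j => by
    obtain ⟨i, -⟩ := hs
    exact hv i j ▸ M.v_nonneg i j
  have havg : ∀ (v : I → ℝ) (hv : ∀ i j, M.v i j = v j) (φ : I → ℝ), (∀ j, 0 < φ j) → ∀ j,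
      M.buyProb φ j = 1 * (M.averaged r hr0 v (hv0 v hv)).buyProb φ j := fun v hv φ _ j => by
    rw [one_mul, TrialOfferMarket.buyProb, TrialOfferMarket.buyProb]
    simp_rw [M.averaged_spending hr0 hr (hv0 v hv) hv]
    simp
  refine ⟨fun hr1 => ?_, fun hr1 q hq hv => ?_, fun hr1 v hv => ?_⟩
  · rcases hcase with ⟨v, hv⟩ | ⟨q, hq⟩
    · exact (M.averaged_isHomogeneous hM hr0 (hv0 v hv) hv).exists_unique_interiorTOME hr1 one_pos
        (havg v hv) hX hd₀'
    -- Part (a) does not assume that every type sees an item, so blind types are removed here. Part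
    -- (b) assumes it, so there M itself is homogeneous.
    · obtain ⟨c, hc, hbuy⟩ := M.restrictSeeing_buyProb hs
      exact (M.restrictSeeing_isHomogeneous hM hr hq hs).exists_unique_interiorTOME hr1 hc
        (fun φ _ => hbuy φ) hX hd₀'
  · have h : M.IsHomogeneous q r := by
      refine ⟨hr, hq, fun j => ?_, hv, fun j => ?_⟩
      · obtain ⟨i, hi⟩ := hM j
        exact hq i j ▸ pos_of_mul_pos_right hi (M.v_nonneg i j)
      · obtain ⟨i, hi⟩ := hM j
        exact ⟨i, pos_of_mul_pos_left hi (M.q_nonneg i j)⟩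
    exact h.exists_ae_tendsto_Gamma hr1 one_pos (fun φ _ j => (one_mul _).symm) hX hd₀'
  · obtain ⟨Γstar, h1, h2⟩ := (M.averaged_isHomogeneous hM hr0 (hv0 v hv) hv).exists_ae_tendsto_Gamma
      hr1 one_pos (havg v hv) hX hd₀'
    refine ⟨Γstar, h1, ?_⟩
    filter_upwards [h2] with ω hω
    refine hω.congr fun t => ?_
    congr 1
    ext i j
    exact M.averaged_spending hr0 hr (hv0 v hv) hv _ i j
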